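/- A \emph{KTB-algebra} is a Boolean algebra (possibly with one element) with a unary operation $\Diamond$ such that $\Diamond 0=0$, $\Diamond(x\vee y)=\Diamond x\vee\Diamond y$, $x\le\Diamond x$ and $x\le\Box\Diamond x$, where $\Box=\neg\Diamond\neg$. A \emph{variety} of KTB-algebras is a class closed under homomorphic images, subalgebras (and isomorphic copies) and arbitrary direct products; varieties are ordered by inclusion, and $\mathrm{Var}(\mathbf A)$ is the least variety containing $\mathbf A$. The \emph{logic} of a variety is the set of modal formulas (over countably many propositional variables) that take the value $1$ under every assignment in every member of the variety. For a simple graph $G$, $\mathsf{Cm}(\mathbb G)$ is the KTB-algebra of all sets of vertices of $G$, with $\Diamond X$ the set of vertices that lie in $X$ or are adjacent to a vertex of $X$; $K_2$ is the complete graph on two vertices. Let $\mathrm{NExt}(\mathbf{KTB})$ be the set of normal modal logics (sets of modal formulas that contain all classical tautologies and all instances of $\Box(\varphi\to\psi)\to(\Box\varphi\to\Box\psi)$ and are closed under modus ponens, necessitation and uniform substitution) that extend $\mathbf{KTB}$, the least normal logic containing $\Box p\to p$ and $p\to\Box\Diamond p$; it is ordered by inclusion. A logic $L$ has \emph{codimension}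 $n$ if there is a chain $L_0\succ L_1\succ\dots\succ L_n=L$ in $\mathrm{NExt}(\mathbf{KTB})$ such that $L_0$ is the inconsistent logic and $L_{i-1}$ covers $L_i$ for $1\le i\le n$. Let $\mathbb E$ be the set of positive even numbers. For $N\subseteq\mathbb E$, let $F_N$ be the simple graph with pairwise distinct vertices $a,b_1,b_2,b_3,c_1,c_2,d$, $u_i$ $(i\ge 1)$, $\ell_i$ $(i\ge 0)$, and the edges $\{a,b_i\}$ $(i=1,2,3)$, $\{b_i,c_i\}$ $(i=1,2)$, $\{c_1,d\}$, $\{\ell_0,\ell_1\}$, $\{a,\ell_i\}$ $(i\ge 0)$, $\{\ell_i,u_i\}$ $(i\ge 1)$, $\{\ell_i,u_{i-1}\}$ $(i\in\mathbb E)$, $\{\ell_i,u_{i+1}\}$ $(i\in N)$ and $\{\ell_{i+1},u_i\}$ $(i\in\mathbb E\setminus N)$. Let $\mathbf D_N$ be the subalgebra of $\mathsf{Cm}(\mathbb F_N)$ generated by the element $\{d\}$. \textbf{Theorem.} The set of logics of codimension $3$ in $\mathrm{NExt}(\mathbf{KTB})$ has cardinality $2^{\aleph_0}$. Dually, the set of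 varieties of KTB-algebras that cover $\mathrm{Var}(\mathsf{Cm}(\mathbb K_2))$ has cardinality $2^{\aleph_0}$. Moreover, for every $N\subseteq\mathbb E$ the variety $\mathrm{Var}(\mathbf D_N)$ covers $\mathrm{Var}(\mathsf{Cm}(\mathbb K_2))$ and its logic is a member of $\mathrm{NExt}(\mathbf{KTB})$ of codimension $3$; and for distinct $N,M\subseteq\mathbb E$ both the varieties $\mathrm{Var}(\mathbf D_N)$, $\mathrm{Var}(\mathbf D_M)$ and their logics are distinct. -/

import Mathlib

/-! ## KTB-algebras -/

/-- A KTB-algebra: a Boolean algebra (possibly with one element) with a unary operation `dia`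
such that `◇0 = 0`, `◇(x ∨ y) = ◇x ∨ ◇y`, `x ≤ ◇x` and `x ≤ □◇x`, where `□y = ¬◇¬y`. -/
class KTBAlgebra (α : Type) extends BooleanAlgebra α where
  dia : α → α
  dia_bot : dia ⊥ = ⊥
  dia_sup : ∀ x y, dia (x ⊔ y) = dia x ⊔ dia y
  le_dia : ∀ x, x ≤ dia x
  le_box_dia : ∀ x, x ≤ (dia (dia x)ᶜ)ᶜ

/-- The dual operation `□x = ¬◇¬x`. -/
def KTBAlgebra.box {α : Type} [KTBAlgebra α] (x : α) : α := (KTBAlgebra.dia xᶜ)ᶜ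

/-- A homomorphism of Boolean algebras (a bounded lattice homomorphism, which automatically
preserves complements) is a homomorphism of KTB-algebras if it commutes with `◇`. -/
def IsModalHom {α β : Type} [KTBAlgebra α] [KTBAlgebra β] (f : BoundedLatticeHom α β) : Prop :=
  ∀ x, f (KTBAlgebra.dia x) = KTBAlgebra.dia (f x)

/-- Direct products, with coordinatewise operations. -/
instance KTBAlgebra.instPi {ι : Type} (α : ι → Type) [∀ i, KTBAlgebra (α i)] :
    KTBAlgebra (∀ i, α i) where
  dia x := fun i => KTBAlgebra.dia (x i)
  dia_bot := funext fun _ => KTBAlgebra.dia_bot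
  dia_sup x y := funext fun i => KTBAlgebra.dia_sup (x i) (y i)
  le_dia x := fun i => KTBAlgebra.le_dia (x i)
  le_box_dia x := fun i => KTBAlgebra.le_box_dia (x i)

/-- Subalgebras: Boolean subalgebras closed under `◇`. -/
structure KTBSubalgebra (α : Type) [KTBAlgebra α] extends BooleanSubalgebra α where
  dia_mem' : ∀ {x}, x ∈ carrier → KTBAlgebra.dia x ∈ carrier

/-- A subalgebra is a KTB-algebra with the restricted operations. -/
instance KTBSubalgebra.instKTBAlgebra {α : Type} [KTBAlgebra α] (S : KTBSubalgebra α) :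
    KTBAlgebra S.toBooleanSubalgebra where
  dia x := ⟨KTBAlgebra.dia x.1, S.dia_mem' x.2⟩
  dia_bot := Subtype.ext KTBAlgebra.dia_bot
  dia_sup x y := Subtype.ext (KTBAlgebra.dia_sup x.1 y.1)
  le_dia x := KTBAlgebra.le_dia x.1
  le_box_dia x := KTBAlgebra.le_box_dia x.1

/-- The subalgebra generated by a set `s`: the intersection of all subalgebras containing `s`. -/
def KTBSubalgebra.generate {α : Type} [KTBAlgebra α] (s : Set α) : KTBSubalgebra α where
  carrier := {x | ∀ S : KTBSubalgebra α, s ⊆ S.carrier → x ∈ S.carrier}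
  supClosed' _ hx _ hy := fun S hS => S.supClosed' (hx S hS) (hy S hS)
  infClosed' _ hx _ hy := fun S hS => S.infClosed' (hx S hS) (hy S hS)
  compl_mem' hx := fun S hS => S.compl_mem' (hx S hS)
  bot_mem' := fun S _ => S.bot_mem'
  dia_mem' hx := fun S hS => S.dia_mem' (hx S hS)

/-- A bundled KTB-algebra. -/
structure KTBAlg : Type 1 where
  carrier : Type
  [str : KTBAlgebra carrier]

instance KTBAlg.instKTBAlgebra (A : KTBAlg) : KTBAlgebra A.carrier := A.str

/-! ## Varieties of KTB-algebras -/

/-- A variety of KTB-algebras: a class of KTB-algebras closed under homomorphic images,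
(isomorphic copies of) subalgebras, and arbitrary direct products (the empty product, that is the
one-element algebra, included). -/
@[ext]
structure KTBVariety : Type 1 where
  members : Set KTBAlg
  hom_mem : ∀ (A B : KTBAlg) (f : BoundedLatticeHom A.carrier B.carrier), IsModalHom f →
    Function.Surjective f → A ∈ members → B ∈ members
  sub_mem : ∀ (A B : KTBAlg) (f : BoundedLatticeHom B.carrier A.carrier), IsModalHom f →
    Function.Injective f → A ∈ members → B ∈ members
  prod_mem : ∀ (ι : Type) (A : ι → KTBAlg), (∀ i, A i ∈ members) →
    KTBAlg.mk (∀ i, (A i).carrier) ∈ members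

/-- The varieties of KTB-algebras, ordered by inclusion. -/
instance KTBVariety.instPartialOrder : PartialOrder KTBVariety :=
  PartialOrder.lift KTBVariety.members fun _ _ h => KTBVariety.ext h

/-- The variety generated by a class of KTB-algebras: the smallest variety containing it. -/
def KTBVariety.generatedBy (C : Set KTBAlg) : KTBVariety where
  members := {A | ∀ V : KTBVariety, C ⊆ V.members → A ∈ V.members}
  hom_mem A B f hf hs hA := fun V hV => V.hom_mem A B f hf hs (hA V hV)
  sub_mem A B f hf hi hA := fun V hV => V.sub_mem A B f hf hi (hA V hV)
  prod_mem ι A hA := fun V hV => V.prod_mem ι A fun i => hA i V hV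

/-! ## Complex algebras of graphs -/

/-- The universe of the complex algebra of (the Kripke frame of) a graph: all sets of vertices. -/
def ComplexAlgebra {V : Type} (_G : SimpleGraph V) : Type := Set V

instance ComplexAlgebra.instBooleanAlgebra {V : Type} (G : SimpleGraph V) :
    BooleanAlgebra (ComplexAlgebra G) := inferInstanceAs (BooleanAlgebra (Set V))

/-- The complex algebra of the Kripke frame whose accessibility relation is the reflexive closure
of the adjacency relation: `◇X` is the set of vertices that lie in `X` or have a neighbour
in `X`. -/
instance ComplexAlgebra.instKTBAlgebra {V : Type} (G : SimpleGraph V) :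
    KTBAlgebra (ComplexAlgebra G) where
  dia := fun X : Set V => ({v | ∃ w ∈ X, v = w ∨ G.Adj v w} : Set V)
  dia_bot := by
    refine Set.eq_empty_of_forall_notMem ?_
    rintro v ⟨w, hw, -⟩
    exact hw
  dia_sup := by
    intro X Y
    refine Set.ext fun v => ⟨?_, ?_⟩
    · rintro ⟨w, hw | hw, h⟩
      · exact Or.inl ⟨w, hw, h⟩
      · exact Or.inr ⟨w, hw, h⟩
    · rintro (⟨w, hw, h⟩ | ⟨w, hw, h⟩)
      · exact ⟨w, Or.inl hw, h⟩
      · exact ⟨w, Or.inr hw, h⟩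
  le_dia := fun X v hv => ⟨v, hv, Or.inl rfl⟩
  le_box_dia := by
    rintro X v hv ⟨w, hw, h⟩
    exact hw ⟨v, hv, h.imp Eq.symm fun e => e.symm⟩

/-- The complex algebra of a graph, as a bundled KTB-algebra. -/
def Cm {V : Type} (G : SimpleGraph V) : KTBAlg := ⟨ComplexAlgebra G⟩

/-- The complex algebra of the two-element cluster (the looped complete graph on two vertices). -/
def CmK2 : KTBAlg := Cm (⊤ : SimpleGraph (Fin 2))

/-! ## The graphs `F_N` and the algebras `D_N` -/

/-- The set of positive even numbers. -/
def posEven : Set ℕ := {n | 0 < n ∧ Even n}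

/-- The vertices `a`, `b₁`, `b₂`, `b₃`, `c₁`, `c₂`, `d`, `uᵢ` for `i ≥ 1`, and `lᵢ` for `i ≥ 0`. -/
inductive Vertex : Type
  | a | b1 | b2 | b3 | c1 | c2 | d
  | u (i : ℕ) (hi : i ≠ 0)
  | l (i : ℕ)

/-- The edges of the graph associated with `N`, each listed in one direction. -/
inductive EdgeRel (N : Set ℕ) : Vertex → Vertex → Prop
  | a_b1 : EdgeRel N .a .b1
  | a_b2 : EdgeRel N .a .b2
  | a_b3 : EdgeRel N .a .b3
  | b1_c1 : EdgeRel N .b1 .c1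
  | b2_c2 : EdgeRel N .b2 .c2
  | c1_d : EdgeRel N .c1 .d
  | l0_l1 : EdgeRel N (.l 0) (.l 1)
  | a_l (i : ℕ) : EdgeRel N .a (.l i)
  | l_u (i : ℕ) (hi : i ≠ 0) : EdgeRel N (.l i) (.u i hi)
  | l_u_pred (i : ℕ) (_ : i ∈ posEven) (hi : i - 1 ≠ 0) : EdgeRel N (.l i) (.u (i - 1) hi)
  | l_u_succ (i : ℕ) (_ : i ∈ N) (hi : i + 1 ≠ 0) : EdgeRel N (.l i) (.u (i + 1) hi)
  | l_succ_u (i : ℕ) (_ : i ∈ posEven \ N) (hi : i ≠ 0) : EdgeRel N (.l (i + 1)) (.u i hi)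

/-- The graph `F_N` (its loops are added by the passage to the complex algebra). -/
def graphF (N : Set ℕ) : SimpleGraph Vertex := SimpleGraph.fromRel (EdgeRel N)

/-- The algebra `D_N`: the subalgebra of the complex algebra of `F_N` generated by the
element `{d}`. -/
def algD (N : Set ℕ) : KTBAlg :=
  ⟨(KTBSubalgebra.generate
    ({({Vertex.d} : Set Vertex)} : Set (ComplexAlgebra (graphF N)))).toBooleanSubalgebra⟩

/-! ## Modal formulas and normal extensions of the logic KTB -/

/-- Formulas of the basic modal language over countably many propositional variables. -/
inductive ModalFormula : Type
  | var (n : ℕ)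
  | bot
  | imp (φ ψ : ModalFormula)
  | box (φ : ModalFormula)

namespace ModalFormula

def neg (φ : ModalFormula) : ModalFormula := imp φ bot

def dia (φ : ModalFormula) : ModalFormula := neg (box (neg φ))

/-- Uniform substitution of formulas for variables. -/
def subst (σ : ℕ → ModalFormula) : ModalFormula → ModalFormula
  | var n => σ n
  | bot => bot
  | imp φ ψ => imp (subst σ φ) (subst σ ψ)
  | box φ => box (subst σ φ)

/-- Substitution instances of classical propositional tautologies: formulas that are true under
every assignment of truth values to formulas that respects the Boolean connectives (variables and
boxed formulas may take arbitrary values). -/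
def IsTautology (φ : ModalFormula) : Prop :=
  ∀ v : ModalFormula → Prop, ¬ v bot → (∀ ψ χ, v (imp ψ χ) ↔ (v ψ → v χ)) → v φ

/-- The value of a formula in a KTB-algebra under an assignment of elements to variables. -/
def eval {α : Type} [KTBAlgebra α] (v : ℕ → α) : ModalFormula → α
  | var n => v n
  | bot => ⊥
  | imp φ ψ => (eval v φ)ᶜ ⊔ eval v ψ
  | box φ => KTBAlgebra.box (eval v φ)

end ModalFormula

/-- Normal modal logics, identified with their sets of theorems. -/
structure IsNormalLogic (L : Set ModalFormula) : Prop where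
  tautology : ∀ φ : ModalFormula, φ.IsTautology → φ ∈ L
  axiomK : ∀ φ ψ : ModalFormula, ((φ.imp ψ).box.imp (φ.box.imp ψ.box)) ∈ L
  modusPonens : ∀ φ ψ : ModalFormula, φ.imp ψ ∈ L → φ ∈ L → ψ ∈ L
  necessitation : ∀ φ : ModalFormula, φ ∈ L → φ.box ∈ L
  substitution : ∀ (σ : ℕ → ModalFormula) (φ : ModalFormula), φ ∈ L → φ.subst σ ∈ L

/-- The logic KTB: the smallest normal modal logic containing the axioms
T, `□p → p`, and B, `p → □◇p`. -/
def logicKTB : Set ModalFormula :=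
  {φ | ∀ L : Set ModalFormula, IsNormalLogic L →
    ((ModalFormula.var 0).box.imp (ModalFormula.var 0)) ∈ L →
    ((ModalFormula.var 0).imp (ModalFormula.var 0).dia.box) ∈ L → φ ∈ L}

/-- `NExt(KTB)`: the normal (axiomatic) extensions of KTB, ordered by inclusion. -/
def NExtKTB : Type := {L : Set ModalFormula // IsNormalLogic L ∧ logicKTB ⊆ L}

instance NExtKTB.instPartialOrder : PartialOrder NExtKTB :=
  inferInstanceAs (PartialOrder {L : Set ModalFormula // IsNormalLogic L ∧ logicKTB ⊆ L})

/-- The greatest element of `NExt(KTB)` is the inconsistent logic. -/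
instance NExtKTB.instOrderTop : OrderTop NExtKTB where
  top := ⟨Set.univ, ⟨fun _ _ => trivial, fun _ _ => trivial, fun _ _ _ _ => trivial,
    fun _ _ => trivial, fun _ _ _ => trivial⟩, Set.subset_univ _⟩
  le_top L := Set.subset_univ L.1

/-- `x` has codimension `n`: there is a descending chain `⊤ = c₀ ≻ c₁ ≻ ... ≻ cₙ = x` in which
every element covers the next one. -/
def HasCodimension {α : Type} [PartialOrder α] [OrderTop α] (n : ℕ) (x : α) : Prop :=
  ∃ c : Fin (n + 1) → α, c 0 = ⊤ ∧ c (Fin.last n) = x ∧ ∀ i : Fin n, c i.succ ⋖ c i.castSucc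

/-- The logic of a variety: the formulas that take the value `1` under every assignment in every
member of the variety. -/
def KTBVariety.logic (V : KTBVariety) : Set ModalFormula :=
  {φ | ∀ A ∈ V.members, ∀ v : ℕ → A.carrier, φ.eval v = ⊤}

/-!
Varieties of KTB-algebras and normal extensions of KTB are dually isomorphic
(`KTBVariety.orderIsoNExt`): an algebra that validates the logic of a variety lies in the variety
(Birkhoff, `KTBVariety.mem_of_validates`), and a logic is complete for its Lindenbaum algebra
(`NExtKTB.logic_modelVariety`). It therefore suffices to exhibit covers of varieties, and all upper
bounds for cardinalities come from the countability of the set of formulas.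

Suppose a variety `V ⊆ Var(B)` omits `B`, where `B` is generated by one element `g`. Then some
formula `ψ` in one variable belongs to the logic of `V` and is refuted in `B` at `g`
(`KTBVariety.exists_refuted_at_generator`). If `g` is moreover the value of one of finitely many
terms `t` at every element `x` of `B` that violates some condition, then substituting these `t` in
`ψ` forces the condition on the members of `V`. In this way the one-element algebra, the two-element
algebra, `Cm(K₂)` and `D_N` generate a chain of covers, which gives codimension three.

For `D_N` the finite list of terms is `ModalFormula.probes`. The vertices within distance three of
`d` form the path `d, c₁, b₁, a`, and `{d}` is definable from every nonempty set that avoids this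
path (`exists_farProbe`). Let `X` be a set of vertices, not the whole graph, with nonempty interior
`□X`. If no probe has the value `{d}` at `X`, then all listed combinations of the interior and the
complement of `X` are empty or meet the path, and the vertices `b₂`, `c₂`, `b₃` exclude the few
remaining configurations (`exists_probe`). Since `F_N` has diameter five, `□⁵ψ(t(X))` is empty as
soon as `t(X) = {d}`. So `□⁵ψ(t(p))` for all `t` together imply `□p → □□p`. Instances of them also
imply that no point sees all three parts of a partition of the graph, because the closed
neighbourhood of `b₃` has two elements, so that it misses one of the parts. These two conditions on
a KTB-algebra place it in `Var(Cm(K₂))` (`mem_generatedBy_CmK2`).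

To recover `N` from the logic of `D_N`, the set `{l₁}` is given by a term that has the value `∅` at
every set other than `{d}` (`eval_lowerOne_of_ne`). Starting from `{l₁}`, terms that depend only on
`N ∩ {1, …, 2k}` define the segments `{u₁, …, u₂ₖ₊₁}`, and a further term is nonempty if and only if
`2k + 2 ∈ N` (`mem_membershipTest`). At the least number in which two sets `N` and `M` differ, this
yields a formula valid in exactly one of `D_N` and `D_M`.
-/

/-! ### Formulas and their values -/

namespace ModalFormula

/-- The formula `⊥ → ⊥`. -/
def top : ModalFormula := imp bot bot

/-- Conjunction, defined from implication and `⊥`. -/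
def and (φ ψ : ModalFormula) : ModalFormula := neg (imp φ (neg ψ))

/-- Disjunction, defined from implication and `⊥`. -/
def or (φ ψ : ModalFormula) : ModalFormula := imp (neg φ) ψ

/-- The formula `φ ∧ ¬ψ`, whose value is a set difference in a complex algebra. -/
def diff (φ ψ : ModalFormula) : ModalFormula := and φ (neg ψ)

section eval

variable {α : Type} [KTBAlgebra α] (v : ℕ → α) (φ ψ : ModalFormula)

@[simp] theorem eval_var (n : ℕ) : eval v (var n) = v n := rfl

@[simp] theorem eval_bot : eval v bot = ⊥ := rfl

@[simp] theorem eval_imp : eval v (imp φ ψ) = (eval v φ)ᶜ ⊔ eval v ψ := rfl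

@[simp] theorem eval_box : eval v (box φ) = KTBAlgebra.box (eval v φ) := rfl

@[simp] theorem eval_neg : eval v (neg φ) = (eval v φ)ᶜ := by simp [neg]

@[simp] theorem eval_top : eval v top = ⊤ := by simp [top]

@[simp] theorem eval_dia : eval v (dia φ) = KTBAlgebra.dia (eval v φ) := by
  simp [dia, KTBAlgebra.box]

@[simp] theorem eval_and : eval v (and φ ψ) = eval v φ ⊓ eval v ψ := by simp [and]

@[simp] theorem eval_or : eval v (or φ ψ) = eval v φ ⊔ eval v ψ := by simp [or]

@[simp] theorem eval_diff : eval v (diff φ ψ) = eval v φ \ eval v ψ := by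
  simp [diff, sdiff_eq]

theorem eval_imp_eq_top : eval v (imp φ ψ) = ⊤ ↔ eval v φ ≤ eval v ψ := by
  rw [eval_imp, sup_comm, ← himp_eq, himp_eq_top_iff]

theorem eval_subst (σ : ℕ → ModalFormula) :
    eval v (φ.subst σ) = eval (fun n => eval v (σ n)) φ := by
  induction φ with
  | var n => rfl
  | bot => rfl
  | imp φ ψ h₁ h₂ => simp [subst, h₁, h₂]
  | box φ h => simp [subst, h]

theorem eval_pi {ι : Type} {β : ι → Type} [∀ i, KTBAlgebra (β i)] (v : ℕ → ∀ i, β i) (i : ι) :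
    eval v φ i = eval (fun n => v n i) φ := by
  induction φ with
  | var n => rfl
  | bot => rfl
  | imp φ ψ h₁ h₂ => simp only [eval_imp, ← h₁, ← h₂]; rfl
  | box φ h => simp only [eval_box, ← h]; rfl

end eval

end ModalFormula

open ModalFormula in
theorem IsModalHom.map_eval {α β : Type} [KTBAlgebra α] [KTBAlgebra β]
    {f : BoundedLatticeHom α β} (hf : IsModalHom f) (v : ℕ → α) (φ : ModalFormula) :
    f (eval v φ) = eval (fun n => f (v n)) φ := by
  induction φ with
  | var n => rfl
  | bot => exact map_bot f
  | imp φ ψ h₁ h₂ => simp [h₁, h₂, map_sup]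
  | box φ h => simp [h, KTBAlgebra.box, hf _]

namespace KTBAlgebra

variable {α : Type} [KTBAlgebra α]

theorem dia_mono {x y : α} (h : x ≤ y) : dia x ≤ dia y := by
  rw [← sup_eq_right] at h ⊢
  rw [← dia_sup, h]

theorem box_mono {x y : α} (h : x ≤ y) : box x ≤ box y :=
  compl_le_compl (dia_mono (compl_le_compl h))

theorem box_le (x : α) : box x ≤ x := by
  have := compl_le_compl (le_dia xᶜ)
  rwa [compl_compl] at this

@[simp] theorem box_top : box (⊤ : α) = ⊤ := by simp [box, dia_bot]

theorem box_inf (x y : α) : box (x ⊓ y) = box x ⊓ box y := by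
  simp [box, dia_sup]

end KTBAlgebra

/-- A map of Boolean algebras that preserves `⊥` and implication, as a homomorphism. -/
def BoundedLatticeHom.ofImp {α β : Type} [BooleanAlgebra α] [BooleanAlgebra β] (f : α → β)
    (hbot : f ⊥ = ⊥) (himp : ∀ x y, f (xᶜ ⊔ y) = (f x)ᶜ ⊔ f y) : BoundedLatticeHom α β :=
  have hcompl : ∀ x, f xᶜ = (f x)ᶜ := fun x => by simpa [hbot] using himp x ⊥
  have hsup : ∀ x y, f (x ⊔ y) = f x ⊔ f y := fun x y => by simpa [hcompl] using himp xᶜ y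
  { toFun := f
    map_sup' := hsup
    map_inf' := fun x y => by
      have := hcompl (xᶜ ⊔ yᶜ)
      simpa [hsup, hcompl] using this
    map_top' := by simpa [hbot] using hcompl ⊥
    map_bot' := hbot }

/-- The assignment that uses `e` for the even variables and `e'` for the odd ones. -/
def interleave {X : Type} (e e' : ℕ → X) (n : ℕ) : X :=
  if n % 2 = 0 then e (n / 2) else e' (n / 2)

/-- The implication between variants of two formulas that have no variable in common. -/
def ModalFormula.impDisjoint (φ ψ : ModalFormula) : ModalFormula :=
  (φ.subst fun n => .var (2 * n)).imp (ψ.subst fun n => .var (2 * n + 1))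

theorem ModalFormula.eval_impDisjoint {α X : Type} [KTBAlgebra α] (g : X → α) (e e' : ℕ → X)
    (φ ψ : ModalFormula) :
    (φ.impDisjoint ψ).eval (fun n => g (interleave e e' n)) =
      (φ.eval fun n => g (e n))ᶜ ⊔ ψ.eval fun n => g (e' n) := by
  have h : ∀ n, (2 * n + 1) / 2 = n := by omega
  simp [impDisjoint, interleave, eval_subst, h]

/-- The elements of `α` that are values of formulas under assignments with values in the family
`g`; this is the subalgebra generated by the range of `g`. -/
def termSubalgebra {α X : Type} [KTBAlgebra α] [Nonempty X] (g : X → α) : KTBSubalgebra α :=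
  let s : Set α := {x | ∃ (φ : ModalFormula) (e : ℕ → X), φ.eval (fun n => g (e n)) = x}
  have hcompl : ∀ {x}, x ∈ s → xᶜ ∈ s := by
    rintro x ⟨φ, e, rfl⟩
    exact ⟨φ.neg, e, by simp⟩
  have hsup : ∀ {x y}, x ∈ s → y ∈ s → x ⊔ y ∈ s := by
    rintro x y ⟨φ, e, rfl⟩ ⟨ψ, e', rfl⟩
    exact ⟨φ.neg.impDisjoint ψ, interleave e e', by simp [ModalFormula.eval_impDisjoint]⟩
  { carrier := s
    supClosed' := fun _ hx _ hy => hsup hx hy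
    infClosed' := fun x hx y hy => by simpa using hcompl (hsup (hcompl hx) (hcompl hy))
    compl_mem' := hcompl
    bot_mem' := ⟨.bot, fun _ => Classical.arbitrary X, rfl⟩
    dia_mem' := by
      rintro x ⟨φ, e, rfl⟩
      exact ⟨φ.dia, e, by simp⟩ }

theorem mem_termSubalgebra {α X : Type} [KTBAlgebra α] [Nonempty X] {g : X → α} {x : α} :
    x ∈ (termSubalgebra g).toBooleanSubalgebra ↔
      ∃ (φ : ModalFormula) (e : ℕ → X), φ.eval (fun n => g (e n)) = x := Iff.rfl

theorem KTBSubalgebra.isModalHom_subtype {α : Type} [KTBAlgebra α] (S : KTBSubalgebra α) :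
    IsModalHom S.toBooleanSubalgebra.subtype := fun _ => rfl

/-! ### Varieties are determined by their logics -/

theorem KTBVariety.subalgebra_mem (V : KTBVariety) {A : KTBAlg} (hA : A ∈ V.members)
    (S : KTBSubalgebra A.carrier) : KTBAlg.mk S.toBooleanSubalgebra ∈ V.members :=
  V.sub_mem A ⟨S.toBooleanSubalgebra⟩ S.toBooleanSubalgebra.subtype S.isModalHom_subtype
    Subtype.val_injective hA

/-- The variety of all KTB-algebras that validate a set of formulas. -/
def modelVariety (L : Set ModalFormula) : KTBVariety where
  members := {A | ∀ φ ∈ L, ∀ v : ℕ → A.carrier, φ.eval v = ⊤}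
  hom_mem A B f hf hs hA φ hφ v := by
    choose w hw using fun n => hs (v n)
    have := hf.map_eval w φ
    rw [hA φ hφ w, map_top] at this
    rw [this]
    exact congrArg (fun u => φ.eval u) (funext fun n => (hw n).symm)
  sub_mem A B f hf hi hA φ hφ v := by
    refine hi ?_
    rw [hf.map_eval, hA φ hφ, map_top]
  prod_mem ι A hA φ hφ v := by
    funext i
    rw [ModalFormula.eval_pi]
    exact hA i φ hφ _

theorem KTBVariety.generatedBy_le {C : Set KTBAlg} {V : KTBVariety} :
    KTBVariety.generatedBy C ≤ V ↔ C ⊆ V.members :=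
  ⟨fun h _ hA => h fun _ hW => hW hA, fun h _ hA => hA V h⟩

theorem KTBVariety.self_mem_generatedBy (A : KTBAlg) :
    A ∈ (KTBVariety.generatedBy {A}).members := fun _ h => h rfl

/-- The logic of `Var(A)` consists of the formulas valid in `A`. -/
theorem mem_logic_generatedBy {A : KTBAlg} {φ : ModalFormula} :
    φ ∈ (KTBVariety.generatedBy {A}).logic ↔ ∀ v : ℕ → A.carrier, φ.eval v = ⊤ := by
  refine ⟨fun h v => h A (KTBVariety.self_mem_generatedBy A) v, fun h B hB v => ?_⟩
  refine hB (modelVariety {φ}) ?_ φ rfl v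
  rintro _ rfl _ rfl
  exact h

theorem KTBVariety.logic_anti {V W : KTBVariety} (h : V ≤ W) : W.logic ⊆ V.logic :=
  fun _ hφ A hA => hφ A (h hA)

/-- Birkhoff's theorem: an algebra that validates the logic of a variety belongs to the variety. It
is a homomorphic image of the subalgebra, generated by the elements of `A`, of a product of members
of `V` in which every formula refuted in `A` (under an assignment `e`) is refuted. -/
theorem KTBVariety.mem_of_validates (V : KTBVariety) (A : KTBAlg)
    (hA : ∀ φ ∈ V.logic, ∀ v : ℕ → A.carrier, φ.eval v = ⊤) : A ∈ V.members := by
  classical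
  let I := {p : ModalFormula × (ℕ → A.carrier) // p.1.eval p.2 ≠ ⊤}
  have hI : ∀ i : I, ∃ B ∈ V.members, ∃ w : A.carrier → B.carrier,
      i.1.1.eval (fun n => w (i.1.2 n)) ≠ ⊤ := by
    rintro ⟨⟨φ, e⟩, hφ⟩
    -- variables with the same value in `A` are identified, so that an assignment
    -- in `B` that refutes the formula depends on the values in `A` only
    let r : ℕ → ℕ := fun n => Function.invFun e (e n)
    have hr : ∀ n, e (r n) = e n := fun n => Function.invFun_eq ⟨n, rfl⟩
    have h : φ.subst (fun n => .var (r n)) ∉ V.logic := fun h => hφ <| by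
      have := hA _ h e
      simpa only [ModalFormula.eval_subst, ModalFormula.eval_var, hr] using this
    simp only [KTBVariety.logic, Set.mem_ofPred_eq, not_forall] at h
    obtain ⟨B, hB, w, hw⟩ := h
    refine ⟨B, hB, fun a => w (Function.invFun e a), ?_⟩
    simpa only [ModalFormula.eval_subst, ModalFormula.eval_var] using hw
  choose B hB w hw using hI
  let g : A.carrier → ∀ i, (B i).carrier := fun a i => w i a
  have key : ∀ (φ : ModalFormula) (e : ℕ → A.carrier),
      φ.eval (fun n => g (e n)) = ⊤ → φ.eval e = ⊤ := by
    intro φ e h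
    by_contra hne
    refine hw ⟨(φ, e), hne⟩ ?_
    have := congrFun h ⟨(φ, e), hne⟩
    rwa [ModalFormula.eval_pi] at this
  have key' : ∀ (φ ψ : ModalFormula) (e e' : ℕ → A.carrier),
      φ.eval (fun n => g (e n)) = ψ.eval (fun n => g (e' n)) → φ.eval e ≤ ψ.eval e' := by
    intro φ ψ e e' h
    have himp := key (φ.impDisjoint ψ) (interleave e e') <| by
      rw [ModalFormula.eval_impDisjoint, h, compl_sup_eq_top]
    have heval := ModalFormula.eval_impDisjoint id e e' φ ψ
    simp only [id] at heval
    rwa [heval, sup_comm, ← himp_eq, himp_eq_top_iff] at himp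
  have hne : Nonempty A.carrier := ⟨⊥⟩
  let S := termSubalgebra g
  choose φS eS hS using fun x : S.toBooleanSubalgebra => mem_termSubalgebra.1 x.2
  have hf : ∀ (x : S.toBooleanSubalgebra) (ψ : ModalFormula) (e : ℕ → A.carrier),
      ψ.eval (fun n => g (e n)) = x.1 → (φS x).eval (eS x) = ψ.eval e := fun x ψ e h =>
    le_antisymm (key' _ _ _ _ ((hS x).trans h.symm)) (key' _ _ _ _ (h.trans (hS x).symm))
  let f : BoundedLatticeHom S.toBooleanSubalgebra A.carrier :=
    BoundedLatticeHom.ofImp (fun x => (φS x).eval (eS x))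
      (hf _ .bot (fun _ => ⊥) rfl) (by
        intro x y
        rw [hf (xᶜ ⊔ y) ((φS x).impDisjoint (φS y)) (interleave (eS x) (eS y))]
        · exact ModalFormula.eval_impDisjoint id _ _ _ _
        · rw [ModalFormula.eval_impDisjoint, hS, hS]
          rfl)
  refine V.hom_mem ⟨S.toBooleanSubalgebra⟩ A f ?_ ?_
    (V.subalgebra_mem (V.prod_mem I B hB) S)
  · intro x
    refine (hf _ (φS x).dia (eS x) ?_).trans (by simp; rfl)
    rw [ModalFormula.eval_dia, hS]
    rfl
  · intro a
    exact ⟨⟨g a, mem_termSubalgebra.2 ⟨.var 0, fun _ => a, rfl⟩⟩,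
      hf _ (.var 0) (fun _ => a) rfl⟩

theorem KTBVariety.modelVariety_logic (V : KTBVariety) : modelVariety V.logic = V :=
  KTBVariety.ext (Set.Subset.antisymm (fun A hA => V.mem_of_validates A hA)
    fun A hA _ hφ => hφ A hA)

theorem KTBVariety.logic_subset_iff {V W : KTBVariety} : W.logic ⊆ V.logic ↔ V ≤ W :=
  ⟨fun h A hA => W.mem_of_validates A fun _ hφ => h hφ A hA, KTBVariety.logic_anti⟩

theorem KTBVariety.logic_injective : Function.Injective KTBVariety.logic :=
  Function.LeftInverse.injective KTBVariety.modelVariety_logic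

/-! ### The dual isomorphism between normal extensions of KTB and varieties -/

/-- The Boolean prime ideal theorem: an element other than `⊤` is omitted by some ultrafilter, here
a homomorphism to the Boolean algebra of truth values. -/
theorem exists_ultrafilter_omitting {α : Type} [BooleanAlgebra α] {a : α} (ha : a ≠ ⊤) :
    ∃ f : BoundedLatticeHom α Prop, ¬ f a := by
  obtain ⟨J, hJ, haJ, -⟩ := DistribLattice.prime_ideal_of_disjoint_filter_ideal
    (F := Order.PFilter.principal (⊤ : α)) (I := Order.Ideal.principal a) <| by
      refine Set.disjoint_left.2 fun x hx hx' => ha ?_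
      exact top_le_iff.1 (le_trans hx hx')
  have hcompl : ∀ x, xᶜ ∈ J ↔ x ∉ J := fun x => by
    refine ⟨fun h h' => hJ.toIsProper.top_notMem ?_, fun h => hJ.compl_mem_of_notMem h⟩
    have := J.sup_mem h' h
    rwa [sup_compl_eq_top] at this
  refine ⟨BoundedLatticeHom.ofImp (fun x => x ∉ J) ?_ ?_, fun h => h (haJ le_rfl)⟩
  · exact eq_false fun h => h J.bot_mem
  · intro x y
    have : xᶜ ⊔ y ∈ J ↔ xᶜ ∈ J ∧ y ∈ J := Order.Ideal.sup_mem_iff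
    simp only [this, hcompl, compl_iff_not, sup_Prop_eq]
    exact propext (by tauto)

theorem KTBVariety.isNormalLogic_logic (V : KTBVariety) : IsNormalLogic V.logic where
  tautology φ hφ A hA v := by
    by_contra hne
    obtain ⟨f, hf⟩ := exists_ultrafilter_omitting hne
    refine hf (hφ (fun ψ => f (ψ.eval v)) (by simp) fun ψ χ => ?_)
    simp only [ModalFormula.eval_imp, map_sup, map_compl', sup_Prop_eq, compl_iff_not]
    tauto
  axiomK φ ψ A hA v := by
    rw [ModalFormula.eval_imp_eq_top]
    simp only [ModalFormula.eval_box, ModalFormula.eval_imp]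
    rw [sup_comm _ (KTBAlgebra.box _), ← himp_eq, le_himp_iff, ← KTBAlgebra.box_inf]
    refine KTBAlgebra.box_mono ?_
    rw [sup_comm, ← himp_eq]
    exact himp_inf_le
  modusPonens φ ψ h₁ h₂ A hA v := by
    have := ModalFormula.eval_imp_eq_top (v := v) φ ψ |>.1 (h₁ A hA v)
    rwa [h₂ A hA v, top_le_iff] at this
  necessitation φ h A hA v := by simp [h A hA v]
  substitution σ φ h A hA v := by
    rw [ModalFormula.eval_subst]
    exact h A hA _

theorem KTBVariety.logicKTB_subset_logic (V : KTBVariety) : logicKTB ⊆ V.logic := by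
  intro φ hφ
  refine hφ V.logic V.isNormalLogic_logic (fun A hA v => ?_) (fun A hA v => ?_)
  · exact (ModalFormula.eval_imp_eq_top _ _ _).2 (KTBAlgebra.box_le _)
  · refine (ModalFormula.eval_imp_eq_top _ _ _).2 ?_
    simp only [ModalFormula.eval_box, ModalFormula.eval_dia]
    exact KTBAlgebra.le_box_dia _

/-- The logic of a variety as an element of `NExt(KTB)`. -/
def KTBVariety.toNExt (V : KTBVariety) : NExtKTB :=
  ⟨V.logic, V.isNormalLogic_logic, V.logicKTB_subset_logic⟩

namespace NExtKTB

variable (L : NExtKTB)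

/-- A valuation of formulas by truth values that respects the Boolean connectives. -/
def IsBooleanValuation (v : ModalFormula → Prop) : Prop :=
  ¬ v .bot ∧ ∀ ψ χ, v (.imp ψ χ) ↔ (v ψ → v χ)

variable {L} in
theorem mem_of_consequence {φ ψ : ModalFormula} (hφ : φ ∈ L.1)
    (h : ∀ v, IsBooleanValuation v → v φ → v ψ) : ψ ∈ L.1 :=
  L.2.1.modusPonens φ ψ (L.2.1.tautology _ fun v hb hi => (hi _ _).2 (h v ⟨hb, hi⟩)) hφ

variable {L} in
theorem mem_of_consequence₂ {φ ψ χ : ModalFormula} (hφ : φ ∈ L.1) (hψ : ψ ∈ L.1)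
    (h : ∀ v, IsBooleanValuation v → v φ → v ψ → v χ) : χ ∈ L.1 :=
  L.2.1.modusPonens ψ χ (mem_of_consequence hφ fun v hv hφ =>
    (hv.2 _ _).2 (h v hv hφ)) hψ

theorem mem_of_taut {φ : ModalFormula} (h : ∀ v, IsBooleanValuation v → v φ) : φ ∈ L.1 :=
  L.2.1.tautology _ fun v hb hi => h v ⟨hb, hi⟩

theorem reflection_mem (φ : ModalFormula) : φ.box.imp φ ∈ L.1 :=
  L.2.1.substitution (fun _ => φ) _ (L.2.2 fun _ _ h _ => h)

theorem brouwer_mem (φ : ModalFormula) : φ.imp φ.dia.box ∈ L.1 :=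
  L.2.1.substitution (fun _ => φ) _ (L.2.2 fun _ _ _ h => h)

variable {L} in
theorem box_imp_box_mem {φ ψ : ModalFormula} (h : φ.imp ψ ∈ L.1) : φ.box.imp ψ.box ∈ L.1 :=
  L.2.1.modusPonens _ _ (L.2.1.axiomK φ ψ) (L.2.1.necessitation _ h)

/-- Provable equivalence of formulas in a logic. -/
def lindenbaumSetoid : Setoid ModalFormula where
  r φ ψ := φ.imp ψ ∈ L.1 ∧ ψ.imp φ ∈ L.1
  iseqv :=
    { refl := fun φ => ⟨L.mem_of_taut fun v hv => by simp [hv.2],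
        L.mem_of_taut fun v hv => by simp [hv.2]⟩
      symm := And.symm
      trans := fun h₁ h₂ => ⟨mem_of_consequence₂ h₁.1 h₂.1 fun v hv => by
          simp only [hv.2]; tauto, mem_of_consequence₂ h₁.2 h₂.2 fun v hv => by
          simp only [hv.2]; tauto⟩ }

/-- The universe of the Lindenbaum algebra of a logic: formulas modulo provable equivalence. -/
def Lindenbaum : Type := Quotient L.lindenbaumSetoid

namespace Lindenbaum

/-- The class of a formula in the Lindenbaum algebra. -/
def mk (φ : ModalFormula) : Lindenbaum L := Quotient.mk L.lindenbaumSetoid φ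

variable {L}

theorem sound_of_valuation {φ ψ φ' ψ' χ χ' : ModalFormula}
    (h₁ : L.lindenbaumSetoid φ φ') (h₂ : L.lindenbaumSetoid ψ ψ')
    (h : ∀ v, IsBooleanValuation v → (v φ ↔ v φ') → (v ψ ↔ v ψ') → (v χ ↔ v χ')) :
    L.lindenbaumSetoid χ χ' := by
  have hiff : ∀ {α β : ModalFormula}, L.lindenbaumSetoid α β →
      ((α.imp β).and (β.imp α)) ∈ L.1 := fun h => mem_of_consequence₂ h.1 h.2 fun v hv => by
    simp only [ModalFormula.and, ModalFormula.neg, hv.1, hv.2]; tauto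
  constructor <;>
  · refine mem_of_consequence₂ (hiff h₁) (hiff h₂) fun v hv h₁ h₂ => ?_
    have := h v hv
    simp only [ModalFormula.and, ModalFormula.neg, hv.1, hv.2] at h₁ h₂ ⊢
    tauto

instance : BooleanAlgebra (Lindenbaum L) where
  le := Quotient.lift₂ (fun φ ψ => φ.imp ψ ∈ L.1) fun φ ψ φ' ψ' h₁ h₂ => propext
    ⟨fun h => mem_of_consequence₂ (mem_of_consequence₂ h₁.2 h fun v hv h h' =>
        ((hv.2 φ' ψ).2 fun a => (hv.2 _ _).1 h' ((hv.2 _ _).1 h a))) h₂.1 fun v hv => by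
          simp only [hv.2]; tauto,
      fun h => mem_of_consequence₂ (mem_of_consequence₂ h₁.1 h fun v hv h h' =>
        ((hv.2 φ ψ').2 fun a => (hv.2 _ _).1 h' ((hv.2 _ _).1 h a))) h₂.2 fun v hv => by
          simp only [hv.2]; tauto⟩
  le_refl := by
    rintro ⟨φ⟩
    exact L.mem_of_taut fun v hv => by simp [hv.2]
  le_trans := by
    rintro ⟨φ⟩ ⟨ψ⟩ ⟨χ⟩ h₁ h₂
    exact mem_of_consequence₂ h₁ h₂ fun v hv => by simp only [hv.2]; tauto
  le_antisymm := by
    rintro ⟨φ⟩ ⟨ψ⟩ h₁ h₂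
    exact Quotient.sound ⟨h₁, h₂⟩
  sup := Quotient.map₂ ModalFormula.or fun φ φ' h₁ ψ ψ' h₂ =>
    sound_of_valuation h₁ h₂ fun v hv => by
      simp only [ModalFormula.or, ModalFormula.neg, hv.1, hv.2]; tauto
  inf := Quotient.map₂ ModalFormula.and fun φ φ' h₁ ψ ψ' h₂ =>
    sound_of_valuation h₁ h₂ fun v hv => by
      simp only [ModalFormula.and, ModalFormula.neg, hv.1, hv.2]; tauto
  compl := Quotient.map ModalFormula.neg fun φ φ' h =>
    sound_of_valuation h h fun v hv => by
      simp only [ModalFormula.neg, hv.1, hv.2]; tauto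
  top := Quotient.mk _ .top
  bot := Quotient.mk _ .bot
  le_sup_left := by
    rintro ⟨φ⟩ ⟨ψ⟩
    exact L.mem_of_taut fun v hv => by
      simp only [ModalFormula.or, ModalFormula.neg, hv.1, hv.2]; tauto
  le_sup_right := by
    rintro ⟨φ⟩ ⟨ψ⟩
    exact L.mem_of_taut fun v hv => by
      simp only [ModalFormula.or, ModalFormula.neg, hv.1, hv.2]; tauto
  sup_le := by
    rintro ⟨φ⟩ ⟨ψ⟩ ⟨χ⟩ h₁ h₂
    exact mem_of_consequence₂ h₁ h₂ fun v hv => by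
      simp only [ModalFormula.or, ModalFormula.neg, hv.1, hv.2]; tauto
  inf_le_left := by
    rintro ⟨φ⟩ ⟨ψ⟩
    exact L.mem_of_taut fun v hv => by
      simp only [ModalFormula.and, ModalFormula.neg, hv.1, hv.2]; tauto
  inf_le_right := by
    rintro ⟨φ⟩ ⟨ψ⟩
    exact L.mem_of_taut fun v hv => by
      simp only [ModalFormula.and, ModalFormula.neg, hv.1, hv.2]; tauto
  le_inf := by
    rintro ⟨φ⟩ ⟨ψ⟩ ⟨χ⟩ h₁ h₂
    exact mem_of_consequence₂ h₁ h₂ fun v hv => by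
      simp only [ModalFormula.and, ModalFormula.neg, hv.1, hv.2]; tauto
  le_sup_inf := by
    rintro ⟨φ⟩ ⟨ψ⟩ ⟨χ⟩
    exact L.mem_of_taut fun v hv => by
      simp only [ModalFormula.and, ModalFormula.or, ModalFormula.neg, hv.1, hv.2]; tauto
  inf_compl_le_bot := by
    rintro ⟨φ⟩
    exact L.mem_of_taut fun v hv => by
      simp only [ModalFormula.and, ModalFormula.neg, hv.1, hv.2]; tauto
  top_le_sup_compl := by
    rintro ⟨φ⟩
    exact L.mem_of_taut fun v hv => by
      simp only [ModalFormula.or, ModalFormula.neg, hv.1, hv.2]; tauto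
  le_top := by
    rintro ⟨φ⟩
    exact L.mem_of_taut fun v hv => by
      simp only [ModalFormula.top, hv.1, hv.2]; tauto
  bot_le := by
    rintro ⟨φ⟩
    exact L.mem_of_taut fun v hv => by
      simp only [hv.1, hv.2]; tauto

theorem setoid_dia {φ ψ : ModalFormula} (h : L.lindenbaumSetoid φ ψ) :
    L.lindenbaumSetoid φ.dia ψ.dia := by
  have : ∀ {φ ψ : ModalFormula}, φ.imp ψ ∈ L.1 → φ.dia.imp ψ.dia ∈ L.1 := fun {φ ψ} h => by
    have h' : ψ.neg.imp φ.neg ∈ L.1 := mem_of_consequence h fun v hv => by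
      simp only [ModalFormula.neg, hv.1, hv.2]; tauto
    refine mem_of_consequence (box_imp_box_mem h') fun v hv => ?_
    simp only [ModalFormula.dia, ModalFormula.neg, hv.1, hv.2]; tauto
  exact ⟨this h.1, this h.2⟩

instance : KTBAlgebra (Lindenbaum L) where
  dia := Quotient.map ModalFormula.dia fun _ _ h => setoid_dia h
  dia_bot := by
    refine Quotient.sound ⟨?_, L.mem_of_taut fun v hv => by simp [hv.1, hv.2]⟩
    have h : ModalFormula.bot.neg.box ∈ L.1 :=
      L.2.1.necessitation _ (L.mem_of_taut fun v hv => by simp [ModalFormula.neg, hv.2])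
    refine mem_of_consequence h fun v hv => ?_
    simp only [ModalFormula.dia, ModalFormula.neg, hv.1, hv.2]; tauto
  dia_sup := by
    rintro ⟨φ⟩ ⟨ψ⟩
    have hφ : (φ.or ψ).neg.box.imp φ.neg.box ∈ L.1 :=
      box_imp_box_mem <| L.mem_of_taut fun v hv => by
        simp only [ModalFormula.or, ModalFormula.neg, hv.1, hv.2]; tauto
    have hψ : (φ.or ψ).neg.box.imp ψ.neg.box ∈ L.1 :=
      box_imp_box_mem <| L.mem_of_taut fun v hv => by
        simp only [ModalFormula.or, ModalFormula.neg, hv.1, hv.2]; tauto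
    have h₁ : φ.neg.box.imp (ψ.neg.imp (φ.or ψ).neg).box ∈ L.1 :=
      box_imp_box_mem <| L.mem_of_taut fun v hv => by
        simp only [ModalFormula.or, ModalFormula.neg, hv.1, hv.2]; tauto
    have h₂ := L.2.1.axiomK ψ.neg (φ.or ψ).neg
    refine Quotient.sound ⟨mem_of_consequence₂ h₁ h₂ fun v hv => ?_,
      mem_of_consequence₂ hφ hψ fun v hv => ?_⟩ <;>
    · simp only [ModalFormula.dia, ModalFormula.or, ModalFormula.neg, hv.1, hv.2]; tauto
  le_dia := by
    rintro ⟨φ⟩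
    refine mem_of_consequence (L.reflection_mem φ.neg) fun v hv => ?_
    simp only [ModalFormula.dia, ModalFormula.neg, hv.1, hv.2]; tauto
  le_box_dia := by
    rintro ⟨φ⟩
    have h : φ.dia.box.imp φ.dia.neg.neg.box ∈ L.1 :=
      box_imp_box_mem <| L.mem_of_taut fun v hv => by
        simp only [ModalFormula.neg, hv.1, hv.2]; tauto
    refine mem_of_consequence₂ (L.brouwer_mem φ) h fun v hv => ?_
    simp only [ModalFormula.dia, ModalFormula.neg, hv.1, hv.2]; tauto

theorem box_mk (φ : ModalFormula) :
    KTBAlgebra.box (mk L φ) = mk L φ.box := by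
  have h₁ : φ.neg.neg.box.imp φ.box ∈ L.1 := box_imp_box_mem <| L.mem_of_taut fun v hv => by
    simp only [ModalFormula.neg, hv.1, hv.2]; tauto
  have h₂ : φ.box.imp φ.neg.neg.box ∈ L.1 := box_imp_box_mem <| L.mem_of_taut fun v hv => by
    simp only [ModalFormula.neg, hv.1, hv.2]; tauto
  refine Quotient.sound ⟨mem_of_consequence h₁ fun v hv => ?_,
    mem_of_consequence h₂ fun v hv => ?_⟩ <;>
  · simp only [ModalFormula.dia, ModalFormula.neg, hv.1, hv.2]; tauto

/-- Evaluation in the Lindenbaum algebra is substitution. -/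
theorem eval_mk (σ : ℕ → ModalFormula) (φ : ModalFormula) :
    φ.eval (fun n => mk L (σ n)) = mk L (φ.subst σ) := by
  induction φ with
  | var n => rfl
  | bot => rfl
  | imp φ ψ h₁ h₂ =>
    rw [ModalFormula.eval_imp, h₁, h₂]
    refine Quotient.sound ⟨L.mem_of_taut fun v hv => ?_, L.mem_of_taut fun v hv => ?_⟩ <;>
    · simp only [ModalFormula.subst, ModalFormula.or, ModalFormula.neg, hv.1, hv.2]; tauto
  | box φ h => rw [ModalFormula.eval_box, h, box_mk]; rfl

theorem mk_eq_top_iff (φ : ModalFormula) : mk L φ = ⊤ ↔ φ ∈ L.1 := by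
  rw [← top_le_iff]
  constructor
  · refine fun h => L.2.1.modusPonens _ _ h (L.mem_of_taut fun v hv => ?_)
    simp [ModalFormula.top, hv.2]
  · exact fun h => mem_of_consequence h fun v hv h => by simp [hv.2, h]

end Lindenbaum

/-- The completeness theorem: a logic is the set of formulas valid in all its algebras, since it is
the set of formulas valid in its Lindenbaum algebra. -/
theorem logic_modelVariety : (modelVariety L.1).logic = L.1 := by
  refine Set.Subset.antisymm (fun φ hφ => ?_) fun φ hφ A hA v => hA φ hφ v
  have hmem : KTBAlg.mk (Lindenbaum L) ∈ (modelVariety L.1).members := by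
    intro ψ hψ v
    choose σ hσ using fun n => Quotient.exists_rep (v n)
    obtain rfl := funext hσ
    exact (Lindenbaum.eval_mk σ ψ).trans
      ((Lindenbaum.mk_eq_top_iff _).2 (L.2.1.substitution σ ψ hψ))
  have h := hφ _ hmem fun n => Lindenbaum.mk L (.var n)
  have hsubst : φ.subst .var = φ := by
    clear h hφ
    induction φ with
    | var n => rfl
    | bot => rfl
    | imp φ ψ h₁ h₂ => rw [ModalFormula.subst, h₁, h₂]
    | box φ h => rw [ModalFormula.subst, h]
  rwa [Lindenbaum.eval_mk, Lindenbaum.mk_eq_top_iff, hsubst] at h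

end NExtKTB

/-- Varieties of KTB-algebras and normal extensions of KTB are dually isomorphic. -/
def KTBVariety.orderIsoNExt : KTBVariety ≃o NExtKTBᵒᵈ where
  toFun V := OrderDual.toDual V.toNExt
  invFun L := modelVariety (OrderDual.ofDual L).1
  left_inv V := V.modelVariety_logic
  right_inv _ := Subtype.ext (NExtKTB.logic_modelVariety _)
  map_rel_iff' := KTBVariety.logic_subset_iff

theorem KTBVariety.toNExt_covBy {V W : KTBVariety} (h : V ⋖ W) : W.toNExt ⋖ V.toNExt :=
  toDual_covBy_toDual_iff.1 ((apply_covBy_apply_iff KTBVariety.orderIsoNExt).2 h)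

/-! ### Covers of generated varieties -/

theorem KTBVariety.covBy_generatedBy {W : KTBVariety} {B : KTBAlg}
    (hle : W ≤ KTBVariety.generatedBy {B}) (hB : B ∉ W.members)
    (h : ∀ V ≤ KTBVariety.generatedBy {B}, B ∉ V.members → V ≤ W) :
    W ⋖ KTBVariety.generatedBy {B} := by
  refine ⟨lt_of_le_not_ge hle fun h => hB (h (self_mem_generatedBy B)), fun V hWV hVB => ?_⟩
  refine hWV.not_ge (h V hVB.le fun hmem => hVB.not_ge ?_)
  exact generatedBy_le.2 (Set.singleton_subset_iff.2 hmem)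

/-- If a variety omits an algebra generated by one element `g`, then some formula in one variable of
its logic is refuted when the variable takes the value `g`. -/
theorem KTBVariety.exists_refuted_at_generator {V : KTBVariety} {A : KTBAlg} {g : A.carrier}
    (hg : ∀ a, ∃ s : ModalFormula, ∀ v : ℕ → A.carrier, v 0 = g → s.eval v = a)
    (hA : A ∉ V.members) :
    ∃ ψ ∈ V.logic, ∀ v : ℕ → A.carrier, v 0 = g → ψ.eval v ≠ ⊤ := by
  have h := mt (V.mem_of_validates A) hA
  push Not at h
  obtain ⟨φ, hφ, w, hw⟩ := h
  choose s hs using fun n => hg (w n)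
  refine ⟨φ.subst s, V.isNormalLogic_logic.substitution s φ hφ, fun v hv => ?_⟩
  rwa [ModalFormula.eval_subst, funext fun n => hs n v hv]

theorem KTBVariety.mem_generatedBy_of_separated {A B : KTBAlg}
    (h : ∀ a : A.carrier, a ≠ ⊤ → ∃ f : BoundedLatticeHom A.carrier B.carrier,
      IsModalHom f ∧ f a ≠ ⊤) : A ∈ (KTBVariety.generatedBy {B}).members := by
  refine KTBVariety.mem_of_validates _ _ fun φ hφ v => ?_
  by_contra hne
  obtain ⟨f, hf, hfa⟩ := h _ hne
  rw [hf.map_eval] at hfa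
  exact hfa (mem_logic_generatedBy.1 hφ _)

/-! ### Complex algebras of graphs -/

namespace ComplexAlgebra

variable {V : Type} {G : SimpleGraph V}

instance : Membership V (ComplexAlgebra G) := inferInstanceAs (Membership V (Set V))

@[ext] theorem ext {X Y : ComplexAlgebra G} (h : ∀ v, v ∈ X ↔ v ∈ Y) : X = Y := Set.ext h

@[simp] theorem mem_sup {X Y : ComplexAlgebra G} {v : V} : v ∈ X ⊔ Y ↔ v ∈ X ∨ v ∈ Y := Iff.rfl

@[simp] theorem mem_inf {X Y : ComplexAlgebra G} {v : V} : v ∈ X ⊓ Y ↔ v ∈ X ∧ v ∈ Y := Iff.rfl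

@[simp] theorem mem_sdiff {X Y : ComplexAlgebra G} {v : V} : v ∈ X \ Y ↔ v ∈ X ∧ v ∉ Y := Iff.rfl

@[simp] theorem mem_compl {X : ComplexAlgebra G} {v : V} : v ∈ Xᶜ ↔ v ∉ X := Iff.rfl

@[simp] theorem mem_top {v : V} : v ∈ (⊤ : ComplexAlgebra G) := trivial

@[simp] theorem notMem_bot {v : V} : v ∉ (⊥ : ComplexAlgebra G) := fun h => h

theorem mem_dia {X : ComplexAlgebra G} {v : V} :
    v ∈ KTBAlgebra.dia X ↔ ∃ w ∈ X, v = w ∨ G.Adj v w := Iff.rfl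

theorem mem_box {X : ComplexAlgebra G} {v : V} :
    v ∈ KTBAlgebra.box X ↔ ∀ w, v = w ∨ G.Adj v w → w ∈ X := by
  simp only [KTBAlgebra.box, mem_compl, mem_dia]
  exact ⟨fun h w hw => by_contra fun hwX => h ⟨w, hwX, hw⟩, fun h ⟨w, hwX, hw⟩ => hwX (h w hw)⟩

theorem eq_top_iff {X : ComplexAlgebra G} : X = ⊤ ↔ ∀ v, v ∈ X :=
  ⟨fun h _ => h ▸ mem_top, fun h => ext fun v => ⟨fun _ => mem_top, fun _ => h v⟩⟩

theorem eq_bot_iff {X : ComplexAlgebra G} : X = ⊥ ↔ ∀ v, v ∉ X :=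
  ⟨fun h _ => h ▸ notMem_bot, fun h => ext fun v => ⟨fun h' => (h v h').elim, fun h' => h'.elim⟩⟩

/-- The homomorphism to a complex algebra given by a family of ultrafilters indexed by the
vertices. -/
def ofUltrafilters {α : Type} [BooleanAlgebra α] (F : V → BoundedLatticeHom α Prop) :
    BoundedLatticeHom α (ComplexAlgebra G) :=
  BoundedLatticeHom.ofImp (fun x => ({v | F v x} : Set V))
    (ext fun v => by
      change F v ⊥ ↔ False
      simp)
    (fun x y => ext fun v => by
      change F v (xᶜ ⊔ y) ↔ ¬ F v x ∨ F v y
      simp [map_sup])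

theorem mem_ofUltrafilters {α : Type} [BooleanAlgebra α] {F : V → BoundedLatticeHom α Prop}
    {x : α} {v : V} : v ∈ (ofUltrafilters F x : ComplexAlgebra G) ↔ F v x := Iff.rfl

end ComplexAlgebra

theorem mem_logic_generatedBy_Cm {V : Type} {G : SimpleGraph V} {φ : ModalFormula} :
    φ ∈ (KTBVariety.generatedBy {Cm G}).logic ↔ ∀ v : ℕ → ComplexAlgebra G, φ.eval v = ⊤ :=
  mem_logic_generatedBy

/-! ### The varieties of codimension at most two -/

/-- The variety of one-element algebras. -/
def trivialVariety : KTBVariety := modelVariety {.bot}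

theorem KTBVariety.le_trivialVariety {V : KTBVariety} (h : .bot ∈ V.logic) : V ≤ trivialVariety :=
  fun A hA φ hφ v => by
    obtain rfl := hφ
    exact h A hA v

theorem trivialVariety_le (V : KTBVariety) : trivialVariety ≤ V := fun A hA => by
  refine V.mem_of_validates A fun φ _ v => top_le_iff.1 ?_
  have h : (⊥ : A.carrier) = ⊤ := hA .bot rfl fun _ => ⊥
  exact h ▸ bot_le

theorem toNExt_trivialVariety : trivialVariety.toNExt = ⊤ := by
  refine top_le_iff.1 fun φ _ => ?_
  rw [show trivialVariety.toNExt.1 = trivialVariety.logic from rfl]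
  intro A hA v
  have h : (⊥ : A.carrier) = ⊤ := hA .bot rfl fun _ => ⊥
  exact top_le_iff.1 (h ▸ bot_le)

/-- The complex algebra of a single reflexive point: the two-element algebra. -/
def CmK1 : KTBAlg := Cm (⊤ : SimpleGraph (Fin 1))

theorem exists_formula_CmK1 (S : ComplexAlgebra (⊤ : SimpleGraph (Fin 1))) :
    ∃ s : ModalFormula, ∀ v : ℕ → ComplexAlgebra (⊤ : SimpleGraph (Fin 1)),
      v 0 = ⊥ → s.eval v = S := by
  by_cases hS : (0 : Fin 1) ∈ S
  · refine ⟨.top, fun v _ => (ModalFormula.eval_top v).trans (Eq.symm ?_)⟩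
    refine ComplexAlgebra.eq_top_iff.2 fun j => ?_
    rwa [Subsingleton.elim j 0]
  · refine ⟨.bot, fun v _ => (ModalFormula.eval_bot v).trans (Eq.symm ?_)⟩
    refine ComplexAlgebra.eq_bot_iff.2 fun j => ?_
    rwa [Subsingleton.elim j 0]

theorem trivialVariety_covBy : trivialVariety ⋖ KTBVariety.generatedBy {CmK1} := by
  refine KTBVariety.covBy_generatedBy (trivialVariety_le _) (fun h => ?_) fun V hV hB => ?_
  · have : (⊥ : ComplexAlgebra (⊤ : SimpleGraph (Fin 1))) = ⊤ := h .bot rfl fun _ => ⊥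
    exact ComplexAlgebra.eq_top_iff.1 this 0
  · obtain ⟨ψ, hψ, href⟩ := KTBVariety.exists_refuted_at_generator exists_formula_CmK1 hB
    refine KTBVariety.le_trivialVariety ?_
    -- the closed instance of `ψ` takes the value `⊥` in the two-element algebra
    refine V.isNormalLogic_logic.modusPonens (ψ.subst fun _ => .bot) _ ?_
      (V.isNormalLogic_logic.substitution _ ψ hψ)
    refine KTBVariety.logic_anti hV (mem_logic_generatedBy_Cm.2 fun v => ?_)
    rw [ModalFormula.eval_imp_eq_top, ModalFormula.eval_subst]
    have := href (fun _ => (⊥ : ComplexAlgebra (⊤ : SimpleGraph (Fin 1)))) rfl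
    rw [ModalFormula.eval_bot, le_bot_iff, ComplexAlgebra.eq_bot_iff]
    exact fun i hi => this (ComplexAlgebra.eq_top_iff.2 fun j => Subsingleton.elim i j ▸ hi)

/-- An algebra in which `◇` is the identity belongs to the variety of every complex algebra. -/
theorem mem_generatedBy_Cm_of_dia_le {A : KTBAlg} {V : Type} [Nonempty V] {G : SimpleGraph V}
    (h : ∀ x : A.carrier, KTBAlgebra.dia x ≤ x) :
    A ∈ (KTBVariety.generatedBy {Cm G}).members := by
  refine KTBVariety.mem_generatedBy_of_separated fun a ha => ?_
  obtain ⟨F, hF⟩ := exists_ultrafilter_omitting ha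
  refine ⟨ComplexAlgebra.ofUltrafilters (G := G) fun _ => F,
    fun x => ComplexAlgebra.ext (G := G) fun v => ?_, fun htop => ?_⟩
  · have hx : KTBAlgebra.dia x = x := le_antisymm (h x) (KTBAlgebra.le_dia x)
    refine Iff.trans ?_ ComplexAlgebra.mem_dia.symm
    simp only [hx]
    exact ⟨fun h => ⟨v, h, Or.inl rfl⟩, fun ⟨_, h, _⟩ => h⟩
  · exact hF (ComplexAlgebra.mem_ofUltrafilters.1
      (ComplexAlgebra.eq_top_iff.1 htop (Classical.arbitrary V)))

theorem CmK1_dia_le (x : ComplexAlgebra (⊤ : SimpleGraph (Fin 1))) : KTBAlgebra.dia x ≤ x := by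
  rintro i ⟨j, hj, -⟩
  rwa [Subsingleton.elim i j]

/-- The universe of the complex algebra of `K₂`. -/
abbrev AlgK2 : Type := ComplexAlgebra (⊤ : SimpleGraph (Fin 2))

namespace AlgK2

theorem mem_dia {S : AlgK2} {i : Fin 2} :
    i ∈ KTBAlgebra.dia S ↔ (0 : Fin 2) ∈ S ∨ (1 : Fin 2) ∈ S := by
  rw [ComplexAlgebra.mem_dia]
  fin_cases i <;> simp [Fin.exists_fin_two]

theorem eq_top_iff {S : AlgK2} : S = ⊤ ↔ (0 : Fin 2) ∈ S ∧ (1 : Fin 2) ∈ S := by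
  rw [ComplexAlgebra.eq_top_iff, Fin.forall_fin_two]

/-- The atom `{0}`, which generates the algebra. -/
def atom : AlgK2 := ({0} : Set (Fin 2))

theorem mem_atom {i : Fin 2} : i ∈ atom ↔ i = 0 := Iff.rfl

theorem box_eq_bot {S : AlgK2} (hS : S ≠ ⊤) : KTBAlgebra.box S = ⊥ := by
  rw [Ne, eq_top_iff] at hS
  rw [ComplexAlgebra.eq_bot_iff]
  intro i
  simp only [KTBAlgebra.box, ComplexAlgebra.mem_compl, mem_dia]
  tauto

end AlgK2

theorem exists_hom_AlgK2 {α : Type} [KTBAlgebra α] {x : α} (hx : KTBAlgebra.dia x = ⊤)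
    (hx' : KTBAlgebra.dia xᶜ = ⊤) (hα : (⊥ : α) ≠ ⊤) :
    ∃ f : BoundedLatticeHom AlgK2 α, IsModalHom f ∧ ∀ S, S ≠ ⊤ → f S ≠ ⊤ := by
  classical
  let f : AlgK2 → α := fun S =>
    (if (0 : Fin 2) ∈ S then x else ⊥) ⊔ (if (1 : Fin 2) ∈ S then xᶜ else ⊥)
  refine ⟨BoundedLatticeHom.ofImp f ?_ ?_, fun S => ?_, fun S hS htop => ?_⟩
  · simp only [f, ComplexAlgebra.notMem_bot, if_false, sup_bot_eq]
  · intro S T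
    by_cases h0 : (0 : Fin 2) ∈ S <;> by_cases h1 : (1 : Fin 2) ∈ S <;>
    by_cases h2 : (0 : Fin 2) ∈ T <;> by_cases h3 : (1 : Fin 2) ∈ T <;>
    simp [f, h0, h1, h2, h3, sup_comm]
  · change f (KTBAlgebra.dia S) = KTBAlgebra.dia (f S)
    by_cases h0 : (0 : Fin 2) ∈ S <;> by_cases h1 : (1 : Fin 2) ∈ S <;>
    simp [f, AlgK2.mem_dia, h0, h1, hx, hx', KTBAlgebra.dia_bot,
      top_le_iff.1 (KTBAlgebra.le_dia ⊤)]
  · change f S = ⊤ at htop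
    refine hS (AlgK2.eq_top_iff.2 ?_)
    have key : ∀ y : α, KTBAlgebra.dia y = ⊤ → y ≠ ⊥ := fun y hy h => hα <| by
      rw [← hy, h, KTBAlgebra.dia_bot]
    by_cases h0 : (0 : Fin 2) ∈ S <;> by_cases h1 : (1 : Fin 2) ∈ S <;>
    simp [f, h0, h1] at htop ⊢
    · exact key _ hx' (by simp [htop])
    · exact key _ hx (by simp [htop])
    · exact hα htop

/-- The complex algebra of `K₂` embeds into every algebra that has an element such that it and its
complement are both dense. -/
theorem CmK2_mem_generatedBy {A : KTBAlg} {x : A.carrier} (hx : KTBAlgebra.dia x = ⊤)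
    (hx' : KTBAlgebra.dia xᶜ = ⊤) (hA : (⊥ : A.carrier) ≠ ⊤) :
    CmK2 ∈ (KTBVariety.generatedBy {A}).members := by
  obtain ⟨f, hf, hne⟩ := exists_hom_AlgK2 hx hx' hA
  exact KTBVariety.mem_generatedBy_of_separated fun S hS => ⟨f, hf, hne S hS⟩

theorem exists_formula_AlgK2 (S : AlgK2) : ∃ s : ModalFormula, ∀ v : ℕ → AlgK2,
    v 0 = AlgK2.atom → s.eval v = S := by
  classical
  refine ⟨.or (if (0 : Fin 2) ∈ S then .var 0 else .bot)
    (if (1 : Fin 2) ∈ S then (ModalFormula.var 0).neg else .bot), fun v hv => ?_⟩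
  have h0 : (0 : Fin 2) ∈ v 0 := hv ▸ AlgK2.mem_atom.2 rfl
  have h1 : (1 : Fin 2) ∉ v 0 := by simp [hv, AlgK2.mem_atom]
  refine ComplexAlgebra.ext ?_
  rw [Fin.forall_fin_two]
  by_cases h2 : (0 : Fin 2) ∈ S <;> by_cases h3 : (1 : Fin 2) ∈ S <;>
  simp [h0, h1, h2, h3]

theorem generatedBy_CmK1_covBy :
    KTBVariety.generatedBy {CmK1} ⋖ KTBVariety.generatedBy {CmK2} := by
  refine KTBVariety.covBy_generatedBy ?_ (fun h => ?_) fun V hV hB => ?_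
  · exact KTBVariety.generatedBy_le.2 (Set.singleton_subset_iff.2
      (mem_generatedBy_Cm_of_dia_le CmK1_dia_le))
  · have hmem : (ModalFormula.dia (.var 0)).imp (.var 0) ∈
        (KTBVariety.generatedBy {CmK1}).logic := mem_logic_generatedBy_Cm.2 fun v => by
      rw [ModalFormula.eval_imp_eq_top, ModalFormula.eval_dia]
      exact CmK1_dia_le _
    have hle := (ModalFormula.eval_imp_eq_top (α := AlgK2) _ _ _).1
      (hmem CmK2 h fun _ => AlgK2.atom)
    have h1 : (1 : Fin 2) ∈ AlgK2.atom := hle <| by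
      rw [ModalFormula.eval_dia (α := AlgK2)]
      exact AlgK2.mem_dia.2 (Or.inl rfl)
    simp [AlgK2.mem_atom] at h1
  · obtain ⟨ψ, hψ, href⟩ := KTBVariety.exists_refuted_at_generator exists_formula_AlgK2 hB
    refine fun A hA => mem_generatedBy_Cm_of_dia_le fun x => ?_
    let χ : ModalFormula := (ψ.subst fun _ => .var 0).box.and (ψ.subst fun _ => .neg (.var 0)).box
    have hχ : χ.imp ((ModalFormula.dia (.var 0)).imp (.var 0)) ∈ V.logic := by
      refine KTBVariety.logic_anti hV (mem_logic_generatedBy_Cm.2 fun (v : ℕ → AlgK2) => ?_)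
      rw [ModalFormula.eval_imp_eq_top]
      have key : ∀ φ : ModalFormula, (0 : Fin 2) ∈ φ.eval v → (1 : Fin 2) ∉ φ.eval v →
          (ψ.subst fun _ => φ).box.eval v = ⊥ := fun φ h0 h1 => by
        refine AlgK2.box_eq_bot ?_
        rw [ModalFormula.eval_subst]
        exact href _ (ComplexAlgebra.ext (Fin.forall_fin_two.2
          ⟨by simpa [AlgK2.mem_atom], by simpa [AlgK2.mem_atom]⟩))
      -- either the variable or its complement takes the value `{0}`, or `◇` fixes the value
      by_cases h0 : (0 : Fin 2) ∈ v 0 <;> by_cases h1 : (1 : Fin 2) ∈ v 0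
      · have : v 0 = ⊤ := AlgK2.eq_top_iff.2 ⟨h0, h1⟩
        simp [this]
      · simp only [χ, ModalFormula.eval_and, key (.var 0) h0 h1, bot_inf_eq, bot_le]
      · simp only [χ, ModalFormula.eval_and, key (.neg (.var 0)) (by simpa) (by simpa),
          inf_bot_eq, bot_le]
      · have : v 0 = ⊥ := ComplexAlgebra.eq_bot_iff.2 (Fin.forall_fin_two.2 ⟨h0, h1⟩)
        simp [this, KTBAlgebra.dia_bot]
    have h₁ : ∀ φ, (ψ.subst fun _ => φ).box ∈ V.logic := fun φ =>
      V.isNormalLogic_logic.necessitation _ (V.isNormalLogic_logic.substitution _ ψ hψ)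
    have := V.isNormalLogic_logic.modusPonens _ _ hχ
      (NExtKTB.mem_of_consequence₂ (L := V.toNExt) (h₁ _) (h₁ _) fun v hv h h' => by
        simp only [χ, ModalFormula.and, ModalFormula.neg, hv.1, hv.2] at h h' ⊢
        tauto)
    simpa using (ModalFormula.eval_imp_eq_top _ _ _).1 (this A hA fun _ => x)

/-- An algebra in which `◇` is idempotent, and in which no point of one part of a partition of `⊤`
in three parts sees both other parts, belongs to `Var(Cm(K₂))`. The two points of a homomorphism to
`Cm(K₂)` are an ultrafilter `F` and the only other ultrafilter in its cluster, which exists unless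
`◇x ∈ F` implies `x ∈ F`. -/
theorem mem_generatedBy_CmK2 {A : KTBAlg}
    (h4 : ∀ x : A.carrier, KTBAlgebra.dia (KTBAlgebra.dia x) ≤ KTBAlgebra.dia x)
    (halt : ∀ e y : A.carrier,
      e ⊓ (KTBAlgebra.dia (y \ e) ⊓ KTBAlgebra.dia (yᶜ \ e)) = ⊥) :
    A ∈ (KTBVariety.generatedBy {CmK2}).members := by
  refine KTBVariety.mem_generatedBy_of_separated fun a ha => ?_
  obtain ⟨F, hF⟩ := exists_ultrafilter_omitting ha
  have hmono : ∀ {x y : A.carrier}, x ≤ y → F x → F y := fun {x y} h hx => by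
    have := OrderHomClass.mono F h
    exact this hx
  have hsup : ∀ x y : A.carrier, F (x ⊔ y) ↔ F x ∨ F y := fun x y => by simp
  have hinf : ∀ x y : A.carrier, F (x ⊓ y) ↔ F x ∧ F y := fun x y => by simp
  have hcompl : ∀ x : A.carrier, F xᶜ ↔ ¬ F x := fun x => by simp
  have hbot : ¬ F ⊥ := by simp
  -- a second ultrafilter that together with `F` determines `◇` yields the homomorphism
  suffices h : ∃ F' : BoundedLatticeHom A.carrier Prop,
      ∀ x, (F (KTBAlgebra.dia x) ↔ F x ∨ F' x) ∧ (F' (KTBAlgebra.dia x) ↔ F x ∨ F' x) by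
    obtain ⟨F', h⟩ := h
    refine ⟨ComplexAlgebra.ofUltrafilters (G := (⊤ : SimpleGraph (Fin 2))) ![F, F'],
      fun x => ComplexAlgebra.ext (G := (⊤ : SimpleGraph (Fin 2))) fun i => ?_, fun htop => ?_⟩
    · refine Iff.trans ?_ AlgK2.mem_dia.symm
      fin_cases i
      · exact (h x).1
      · exact (h x).2
    · exact hF (ComplexAlgebra.mem_ofUltrafilters.1 (ComplexAlgebra.eq_top_iff.1 htop 0))
  by_cases hcluster : ∀ x, F (KTBAlgebra.dia x) → F x
  · have h : ∀ x, F (KTBAlgebra.dia x) ↔ F x ∨ F x := fun x =>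
      ⟨fun h => Or.inl (hcluster x h), fun h => hmono (KTBAlgebra.le_dia x) (by tauto)⟩
    exact ⟨F, fun x => ⟨h x, h x⟩⟩
  push Not at hcluster
  obtain ⟨e', hdia, he'⟩ := hcluster
  obtain ⟨e, rfl⟩ : ∃ e, e' = eᶜ := ⟨e'ᶜ, by simp⟩
  have he : F e := by simpa [hcompl] using he'
  have hor : ∀ y, F (KTBAlgebra.dia (y \ e)) ∨ F (KTBAlgebra.dia (yᶜ \ e)) := fun y => by
    rw [← hsup, ← KTBAlgebra.dia_sup, ← sup_sdiff, sup_compl_eq_top, top_sdiff]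
    exact hdia
  have hnand : ∀ {e}, F e → ∀ y,
      ¬ (F (KTBAlgebra.dia (y \ e)) ∧ F (KTBAlgebra.dia (yᶜ \ e))) := fun {e} he y h => by
    refine hbot ?_
    rw [← halt e y]
    simp only [hinf]
    exact ⟨he, h⟩
  have hidem : ∀ x : A.carrier,
      KTBAlgebra.dia (KTBAlgebra.dia x)ᶜ ≤ (KTBAlgebra.dia x)ᶜ := fun x => by
    have := KTBAlgebra.le_box_dia (KTBAlgebra.dia x)
    rw [le_antisymm (h4 x) (KTBAlgebra.le_dia _)] at this
    exact le_compl_comm.1 this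
  refine ⟨BoundedLatticeHom.ofImp (fun y => F (KTBAlgebra.dia (y \ e))) ?_ ?_, fun x => ?_⟩
  · simp [KTBAlgebra.dia_bot]
  · intro x y
    have hx := hor x
    have hx' := hnand he x
    simp only [sup_sdiff, KTBAlgebra.dia_sup, hsup, compl_iff_not, sup_Prop_eq]
    exact propext (by tauto)
  · have h₁ : F (KTBAlgebra.dia x) ↔ F x ∨ F (KTBAlgebra.dia (x \ e)) := by
      refine ⟨fun h => ?_, ?_⟩
      · by_contra hne
        push Not at hne
        have hmeet : F (KTBAlgebra.dia (x ⊓ e)) := by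
          rw [← sup_inf_sdiff x e, KTBAlgebra.dia_sup, hsup] at h
          tauto
        refine hnand (e := e ⊓ xᶜ) (by rw [hinf, hcompl]; exact ⟨he, hne.1⟩) (x ⊓ e) ⟨?_, ?_⟩
        · refine hmono (KTBAlgebra.dia_mono ?_) hmeet
          rw [le_sdiff]
          exact ⟨le_rfl, disjoint_compl_right.mono inf_le_left inf_le_right⟩
        · refine hmono (KTBAlgebra.dia_mono ?_) hdia
          rw [le_sdiff]
          exact ⟨compl_le_compl inf_le_right, disjoint_compl_left.mono le_rfl inf_le_left⟩
      · rintro (h | h)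
        · exact hmono (KTBAlgebra.le_dia x) h
        · exact hmono (KTBAlgebra.dia_mono sdiff_le) h
    refine ⟨h₁, Iff.trans ?_ h₁⟩
    refine ⟨fun h => hmono ((KTBAlgebra.dia_mono sdiff_le).trans (h4 x)) h, fun h => ?_⟩
    by_contra hne
    have h' := hmono ((KTBAlgebra.dia_mono sdiff_le).trans (hidem x))
      ((hor (KTBAlgebra.dia x)).resolve_left hne)
    exact (hcompl _).1 h' h

/-! ### The closure operator of `F_N` -/

/-- Adjacency of `lᵢ` and `uⱼ` in `F_N`. -/
def LAdjU (N : Set ℕ) (i j : ℕ) : Prop :=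
  i = j ∨ (i ∈ posEven ∧ i = j + 1) ∨ (i ∈ N ∧ j = i + 1) ∨ (j ∈ posEven \ N ∧ i = j + 1)

section graphF

variable {N : Set ℕ} {X : ComplexAlgebra (graphF N)}

theorem mem_dia_graphF {v : Vertex} :
    v ∈ KTBAlgebra.dia X ↔ ∃ w ∈ X, v = w ∨ EdgeRel N v w ∨ EdgeRel N w v := by
  rw [ComplexAlgebra.mem_dia]
  refine exists_congr fun w => and_congr_right fun _ => ?_
  simp only [graphF, SimpleGraph.fromRel_adj]
  tauto

theorem d_mem_dia : .d ∈ KTBAlgebra.dia X ↔ .d ∈ X ∨ .c1 ∈ X := by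
  rw [mem_dia_graphF]
  constructor
  · rintro ⟨w, hw, rfl | h | h⟩
    · exact Or.inl hw
    · cases h
    · cases h; exact Or.inr hw
  · rintro (h | h)
    · exact ⟨_, h, Or.inl rfl⟩
    · exact ⟨_, h, Or.inr (Or.inr .c1_d)⟩

theorem c1_mem_dia : .c1 ∈ KTBAlgebra.dia X ↔ .c1 ∈ X ∨ .d ∈ X ∨ .b1 ∈ X := by
  rw [mem_dia_graphF]
  constructor
  · rintro ⟨w, hw, rfl | h | h⟩
    · exact Or.inl hw
    · cases h; tauto
    · cases h; tauto
  · rintro (h | h | h)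
    · exact ⟨_, h, Or.inl rfl⟩
    · exact ⟨_, h, Or.inr (Or.inl .c1_d)⟩
    · exact ⟨_, h, Or.inr (Or.inr .b1_c1)⟩

theorem b1_mem_dia : .b1 ∈ KTBAlgebra.dia X ↔ .b1 ∈ X ∨ .c1 ∈ X ∨ .a ∈ X := by
  rw [mem_dia_graphF]
  constructor
  · rintro ⟨w, hw, rfl | h | h⟩
    · exact Or.inl hw
    · cases h; tauto
    · cases h; tauto
  · rintro (h | h | h)
    · exact ⟨_, h, Or.inl rfl⟩
    · exact ⟨_, h, Or.inr (Or.inl .b1_c1)⟩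
    · exact ⟨_, h, Or.inr (Or.inr .a_b1)⟩

theorem b2_mem_dia : .b2 ∈ KTBAlgebra.dia X ↔ .b2 ∈ X ∨ .c2 ∈ X ∨ .a ∈ X := by
  rw [mem_dia_graphF]
  constructor
  · rintro ⟨w, hw, rfl | h | h⟩
    · exact Or.inl hw
    · cases h; tauto
    · cases h; tauto
  · rintro (h | h | h)
    · exact ⟨_, h, Or.inl rfl⟩
    · exact ⟨_, h, Or.inr (Or.inl .b2_c2)⟩
    · exact ⟨_, h, Or.inr (Or.inr .a_b2)⟩

theorem b3_mem_dia : .b3 ∈ KTBAlgebra.dia X ↔ .b3 ∈ X ∨ .a ∈ X := by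
  rw [mem_dia_graphF]
  constructor
  · rintro ⟨w, hw, rfl | h | h⟩
    · exact Or.inl hw
    · cases h
    · cases h; tauto
  · rintro (h | h)
    · exact ⟨_, h, Or.inl rfl⟩
    · exact ⟨_, h, Or.inr (Or.inr .a_b3)⟩

theorem c2_mem_dia : .c2 ∈ KTBAlgebra.dia X ↔ .c2 ∈ X ∨ .b2 ∈ X := by
  rw [mem_dia_graphF]
  constructor
  · rintro ⟨w, hw, rfl | h | h⟩
    · exact Or.inl hw
    · cases h
    · cases h; tauto
  · rintro (h | h)
    · exact ⟨_, h, Or.inl rfl⟩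
    · exact ⟨_, h, Or.inr (Or.inr .b2_c2)⟩

theorem a_mem_dia : .a ∈ KTBAlgebra.dia X ↔
    .a ∈ X ∨ .b1 ∈ X ∨ .b2 ∈ X ∨ .b3 ∈ X ∨ ∃ i, .l i ∈ X := by
  rw [mem_dia_graphF]
  constructor
  · rintro ⟨w, hw, rfl | h | h⟩
    · exact Or.inl hw
    · cases h <;> tauto
    · cases h
  · rintro (h | h | h | h | ⟨i, h⟩)
    · exact ⟨_, h, Or.inl rfl⟩
    · exact ⟨_, h, Or.inr (Or.inl .a_b1)⟩
    · exact ⟨_, h, Or.inr (Or.inl .a_b2)⟩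
    · exact ⟨_, h, Or.inr (Or.inl .a_b3)⟩
    · exact ⟨_, h, Or.inr (Or.inl (.a_l i))⟩

theorem u_mem_dia {j : ℕ} {hj : j ≠ 0} : .u j hj ∈ KTBAlgebra.dia X ↔
    .u j hj ∈ X ∨ ∃ i, .l i ∈ X ∧ LAdjU N i j := by
  rw [mem_dia_graphF]
  constructor
  · rintro ⟨w, hw, rfl | h | h⟩
    · exact Or.inl hw
    · cases h
    · refine Or.inr ?_
      cases h with
      | l_u i hi => exact ⟨j, hw, Or.inl rfl⟩
      | l_u_pred i hi hi' => exact ⟨i, hw, Or.inr (Or.inl ⟨hi, by omega⟩)⟩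
      | l_u_succ i hi hi' => exact ⟨i, hw, Or.inr (Or.inr (Or.inl ⟨hi, rfl⟩))⟩
      | l_succ_u i hi hi' => exact ⟨_, hw, Or.inr (Or.inr (Or.inr ⟨hi, rfl⟩))⟩
  · rintro (h | ⟨i, h, rfl | ⟨h', rfl⟩ | ⟨h', rfl⟩ | ⟨h', rfl⟩⟩)
    · exact ⟨_, h, Or.inl rfl⟩
    · exact ⟨_, h, Or.inr (Or.inr (.l_u i hj))⟩
    · exact ⟨_, h, Or.inr (Or.inr (.l_u_pred _ h' hj))⟩
    · exact ⟨_, h, Or.inr (Or.inr (.l_u_succ _ h' hj))⟩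
    · exact ⟨_, h, Or.inr (Or.inr (.l_succ_u _ h' hj))⟩

theorem l_mem_dia {i : ℕ} : .l i ∈ KTBAlgebra.dia X ↔
    .l i ∈ X ∨ .a ∈ X ∨ (i = 0 ∧ .l 1 ∈ X) ∨ (i = 1 ∧ .l 0 ∈ X) ∨
      ∃ j, ∃ hj : j ≠ 0, .u j hj ∈ X ∧ LAdjU N i j := by
  rw [mem_dia_graphF]
  constructor
  · rintro ⟨w, hw, rfl | h | h⟩
    · exact Or.inl hw
    · cases h with
      | l0_l1 => exact Or.inr (Or.inr (Or.inl ⟨rfl, hw⟩))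
      | l_u i hi => exact Or.inr (Or.inr (Or.inr (Or.inr ⟨i, hi, hw, Or.inl rfl⟩)))
      | l_u_pred i hi hi' =>
        exact Or.inr (Or.inr (Or.inr (Or.inr ⟨_, hi', hw, Or.inr (Or.inl ⟨hi, by omega⟩)⟩)))
      | l_u_succ i hi hi' =>
        exact Or.inr (Or.inr (Or.inr (Or.inr ⟨_, hi', hw, Or.inr (Or.inr (Or.inl ⟨hi, rfl⟩))⟩)))
      | l_succ_u i hi hi' =>
        exact Or.inr (Or.inr (Or.inr (Or.inr ⟨_, hi', hw, Or.inr (Or.inr (Or.inr ⟨hi, rfl⟩))⟩)))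
    · cases h with
      | l0_l1 => exact Or.inr (Or.inr (Or.inr (Or.inl ⟨rfl, hw⟩)))
      | a_l => exact Or.inr (Or.inl hw)
  · rintro (h | h | ⟨rfl, h⟩ | ⟨rfl, h⟩ | ⟨j, hj, h, rfl | ⟨h', rfl⟩ | ⟨h', rfl⟩ | ⟨h', rfl⟩⟩)
    · exact ⟨_, h, Or.inl rfl⟩
    · exact ⟨_, h, Or.inr (Or.inr (.a_l i))⟩
    · exact ⟨_, h, Or.inr (Or.inl .l0_l1)⟩
    · exact ⟨_, h, Or.inr (Or.inr .l0_l1)⟩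
    · exact ⟨_, h, Or.inr (Or.inl (.l_u _ hj))⟩
    · exact ⟨_, h, Or.inr (Or.inl (.l_u_pred _ h' hj))⟩
    · exact ⟨_, h, Or.inr (Or.inl (.l_u_succ _ h' hj))⟩
    · exact ⟨_, h, Or.inr (Or.inl (.l_succ_u _ h' hj))⟩

/-- The set `{d}`. -/
def setD (N : Set ℕ) : ComplexAlgebra (graphF N) := ({Vertex.d} : Set Vertex)

@[simp] theorem mem_setD {v : Vertex} : v ∈ setD N ↔ v = .d := Iff.rfl

theorem eq_setD_iff : X = setD N ↔ .d ∈ X ∧ ∀ v, v ≠ .d → v ∉ X :=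
  ⟨fun h => by simp [h], fun h => ComplexAlgebra.ext fun v =>
    ⟨fun hv => by_contra fun hne => h.2 v hne hv, fun hv => mem_setD.1 hv ▸ h.1⟩⟩

/-- Every vertex other than `d` is within distance two of `a`. -/
theorem mem_dia_dia_of_a_mem (h : .a ∈ X) {v : Vertex} (hv : v ≠ .d) :
    v ∈ KTBAlgebra.dia (KTBAlgebra.dia X) := by
  have hl : ∀ i, .l i ∈ KTBAlgebra.dia X := fun i => l_mem_dia.2 (Or.inr (Or.inl h))
  cases v with
  | d => exact absurd rfl hv
  | u j hj => exact u_mem_dia.2 (Or.inr ⟨j, hl j, Or.inl rfl⟩)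
  | l i => exact KTBAlgebra.le_dia (KTBAlgebra.dia X) (hl i)
  | _ => simp [a_mem_dia, b1_mem_dia, b2_mem_dia, b3_mem_dia, c1_mem_dia, c2_mem_dia, h]

theorem a_mem_dia_dia {v : Vertex} (h : v ∈ X) (hv : v ≠ .d) :
    .a ∈ KTBAlgebra.dia (KTBAlgebra.dia X) := by
  rw [a_mem_dia]
  cases v with
  | d => exact absurd rfl hv
  | u j hj =>
    exact Or.inr <| Or.inr <| Or.inr <| Or.inr
      ⟨j, l_mem_dia.2 <| Or.inr <| Or.inr <| Or.inr <| Or.inr ⟨j, hj, h, Or.inl rfl⟩⟩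
  | l i => exact Or.inl (a_mem_dia.2 <| Or.inr <| Or.inr <| Or.inr <| Or.inr ⟨i, h⟩)
  | _ => simp [a_mem_dia, b1_mem_dia, b2_mem_dia, b3_mem_dia, h]

/-- `F_N` has diameter at most five. -/
theorem dia_iterate_five_eq_top (h : X ≠ ⊥) : KTBAlgebra.dia^[5] X = ⊤ := by
  have h' : ∃ v, v ∈ X := by
    by_contra hne
    push Not at hne
    exact h (ComplexAlgebra.eq_bot_iff.2 hne)
  obtain ⟨w, hw⟩ := h'
  have hmono := fun Y : ComplexAlgebra (graphF N) => KTBAlgebra.le_dia Y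
  refine ComplexAlgebra.eq_top_iff.2 fun v => ?_
  simp only [Function.iterate_succ_apply, Function.iterate_zero, id]
  by_cases hwd : w = .d
  · subst hwd
    by_cases hv : v = .d
    · subst hv
      exact hmono _ (hmono _ (hmono _ (hmono _ (hmono _ hw))))
    · refine mem_dia_dia_of_a_mem ?_ hv
      simp [a_mem_dia, b1_mem_dia, c1_mem_dia, hw]
  · have ha := a_mem_dia_dia hw hwd
    by_cases hv : v = .d
    · subst hv
      simp [d_mem_dia, c1_mem_dia, b1_mem_dia, ha]
    · exact hmono _ (mem_dia_dia_of_a_mem ha hv)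

end graphF

/-! ### Term definability of `{d}` -/

namespace ModalFormula

/-- The points at distance more than three, or four, from the value of `s`. -/
def farProbes (s : ModalFormula) : List ModalFormula :=
  [s.dia.dia.dia.neg, s.dia.dia.dia.dia.neg]

/-- Formulas one of which has the value `{d}` in `Cm(F_N)` if `y` and `z` have nonempty values
that are disjoint and not adjacent, up to an exchange of `y` and `z`. -/
def separationProbes (y z : ModalFormula) : List ModalFormula :=
  let w := y.dia.neg
  let m := (y.or z).neg
  [w, w.box] ++ farProbes (w.dia.neg.diff (w.dia.diff w).dia) ++ farProbes y ++
    farProbes (m.diff y.dia) ++ farProbes (y.diff m.dia) ++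
    farProbes (y.diff (m.and z.dia).dia)

/-- Formulas in the variable `p₀` one of which has the value `{d}` in `Cm(F_N)` if the value of
`p₀` is not the whole set of vertices and has a nonempty interior. -/
def probes : List ModalFormula :=
  separationProbes (var 0).box (var 0).neg ++ separationProbes (var 0).neg (var 0).box

end ModalFormula

section probes

open ModalFormula

variable {N : Set ℕ} {v : ℕ → ComplexAlgebra (graphF N)}

/-- The vertices within distance three of `d` are `d`, `c₁`, `b₁`, `a`; the set `{d}` is definable
from every nonempty set that avoids them. -/
theorem exists_farProbe {s : ModalFormula} {w : Vertex} (hw : w ∈ s.eval v)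
    (ha : .a ∉ s.eval v) (hb : .b1 ∉ s.eval v) (hc : .c1 ∉ s.eval v) (hd : .d ∉ s.eval v) :
    ∃ t ∈ farProbes s, t.eval v = setD N := by
  have hwd : w ≠ .d := by rintro rfl; exact hd hw
  by_cases h : .a ∈ KTBAlgebra.dia (s.eval v)
  · refine ⟨s.dia.dia.dia.neg, by simp [farProbes], eq_setD_iff.2 ⟨?_, fun x hx => ?_⟩⟩
    · simp [d_mem_dia, c1_mem_dia, b1_mem_dia, ha, hb, hc, hd]
    · simpa using mem_dia_dia_of_a_mem h hx
  · refine ⟨s.dia.dia.dia.dia.neg, by simp [farProbes], eq_setD_iff.2 ⟨?_, fun x hx => ?_⟩⟩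
    · simp [d_mem_dia, c1_mem_dia, b1_mem_dia, ha, hb, hc, hd, h]
    · simpa using mem_dia_dia_of_a_mem (a_mem_dia_dia hw hwd) hx

variable {y z : ModalFormula}

theorem exists_probe_of_a_mem (hyz : ∀ w, w ∈ z.eval v → w ∉ KTBAlgebra.dia (y.eval v))
    (ha : .a ∈ y.eval v) (hz : .c1 ∈ z.eval v ∨ .d ∈ z.eval v) :
    ∃ t ∈ separationProbes y z, t.eval v = setD N := by
  have hl : ∀ i, .l i ∈ KTBAlgebra.dia (y.eval v) := fun i => l_mem_dia.2 (Or.inr (Or.inl ha))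
  have hcd := hz.imp (hyz _) (hyz _)
  by_cases hc : .c1 ∈ KTBAlgebra.dia (y.eval v)
  · have hd := hcd.resolve_left (not_not.2 hc)
    have hb : .b1 ∈ y.eval v := by
      simp only [d_mem_dia, c1_mem_dia] at hc hd
      tauto
    by_cases hW : ∃ w, w ≠ .d ∧ w ∉ KTBAlgebra.dia (y.eval v)
    · -- `b₃` has no neighbour in the boundary of the complement of `◇Y`
      obtain ⟨w, hwd, hw⟩ := hW
      have haW : .a ∉ KTBAlgebra.dia (KTBAlgebra.dia (y.eval v))ᶜ := by
        simp [a_mem_dia, b1_mem_dia, b2_mem_dia, b3_mem_dia, hl, ha]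
      have hS : .a ∈ KTBAlgebra.dia (KTBAlgebra.dia (KTBAlgebra.dia (y.eval v))ᶜ \
          (KTBAlgebra.dia (y.eval v))ᶜ) := by
        rw [a_mem_dia]
        cases w with
        | d => exact absurd rfl hwd
        | u j hj =>
          refine Or.inr <| Or.inr <| Or.inr <| Or.inr ⟨j, ?_⟩
          rw [ComplexAlgebra.mem_sdiff, l_mem_dia]
          exact ⟨Or.inr <| Or.inr <| Or.inr <| Or.inr ⟨j, hj, hw, Or.inl rfl⟩, not_not.2 (hl j)⟩
        | l i => exact absurd (hl i) hw
        | c2 =>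
          refine Or.inr <| Or.inr <| Or.inl ?_
          rw [ComplexAlgebra.mem_sdiff, b2_mem_dia]
          exact ⟨Or.inr <| Or.inl hw, not_not.2 (b2_mem_dia.2 (Or.inr (Or.inr ha)))⟩
        | c1 => exact absurd hc hw
        | _ => simp [a_mem_dia, b1_mem_dia, b2_mem_dia, b3_mem_dia, ha] at hw
      obtain ⟨t, ht, heq⟩ := exists_farProbe (v := v) (w := .b3)
        (s := y.dia.neg.dia.neg.diff (y.dia.neg.dia.diff y.dia.neg).dia)
        (by simp [b3_mem_dia, a_mem_dia (X := y.eval v), haW, ha])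
        (by
          rw [eval_diff, ComplexAlgebra.mem_sdiff]
          refine fun h => h.2 ?_
          simpa only [eval_dia, eval_diff, eval_neg] using hS)
        (by simp [b1_mem_dia, c1_mem_dia, ha, hd, hb])
        (by simp [c1_mem_dia, hd]) (by simp [d_mem_dia (X := (KTBAlgebra.dia (y.eval v))ᶜ), hd])
      exact ⟨t, by simp [separationProbes, ht], heq⟩
    · push Not at hW
      exact ⟨y.dia.neg, by simp [separationProbes], eq_setD_iff.2 ⟨by simpa using hd,
        fun w hw => by simpa using hW w hw⟩⟩
  · refine ⟨y.dia.neg.box, by simp [separationProbes], eq_setD_iff.2 ⟨?_, fun w hw => ?_⟩⟩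
    · simp only [c1_mem_dia] at hc
      simp [KTBAlgebra.box, d_mem_dia, c1_mem_dia]
      tauto
    · simpa [KTBAlgebra.box] using mem_dia_dia_of_a_mem ha hw

theorem exists_probe_of_a_notMem (hyz : ∀ w, w ∈ z.eval v → w ∉ KTBAlgebra.dia (y.eval v))
    (hay : .a ∉ y.eval v) (haz : .a ∉ z.eval v) (hb : .b1 ∈ y.eval v) (hd : .d ∈ z.eval v) :
    ∃ t ∈ separationProbes y z ++ separationProbes z y, t.eval v = setD N := by
  have hcz : .c1 ∉ z.eval v := fun h => hyz _ h (by simp [c1_mem_dia, hb])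
  have hcy : .c1 ∉ y.eval v := fun h => hyz _ hd (by simp [d_mem_dia, h])
  have hbz : .b1 ∉ z.eval v := fun h => hyz _ h (by simp [b1_mem_dia, hb])
  have hdy : .d ∉ y.eval v := fun h => hyz _ hd (by simp [d_mem_dia, h])
  by_contra hno
  push Not at hno
  -- a listed set that avoids `d`, `c₁`, `b₁`, `a` is empty
  have hfar : ∀ s, (∀ t ∈ farProbes s, t ∈ separationProbes y z ++ separationProbes z y) →
      .a ∉ s.eval v → .b1 ∉ s.eval v → .c1 ∉ s.eval v → .d ∉ s.eval v → ∀ w, w ∉ s.eval v := by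
    intro s hs h₁ h₂ h₃ h₄ w hw
    obtain ⟨t, ht, heq⟩ := exists_farProbe hw h₁ h₂ h₃ h₄
    exact hno t (hs t ht) heq
  by_cases haZ : .a ∈ KTBAlgebra.dia (z.eval v)
  · -- the sets `Y`, `¬(Y ∪ Z)`, `Z` would form a path, which `b₂` and `c₂` exclude
    have h₁ := hfar ((y.or z).neg.diff y.dia) (fun t ht => by simp [separationProbes, ht])
    have h₂ := hfar ((z.or y).neg.diff z.dia) (fun t ht => by simp [separationProbes, ht])
    have h₃ := hfar (y.diff (y.or z).neg.dia) (fun t ht => by simp [separationProbes, ht])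
    have h₄ := hfar (z.diff (z.or y).neg.dia) (fun t ht => by simp [separationProbes, ht])
    have haY : .a ∈ KTBAlgebra.dia (y.eval v) := a_mem_dia.2 (Or.inr (Or.inl hb))
    have hb2 := hyz .b2
    have hc2 := hyz .c2
    simp only [eval_diff, eval_neg, eval_or, eval_dia, ComplexAlgebra.mem_sdiff,
      ComplexAlgebra.mem_compl, ComplexAlgebra.mem_sup, b1_mem_dia, c1_mem_dia, d_mem_dia,
      haY, haZ, hay, haz, hb, hd, hcz, hcy, hbz, hdy, not_true_eq_false, not_false_eq_true,
      or_true, and_true, or_false, and_false, false_and,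
      forall_true_left] at h₁ h₂ h₃ h₄
    have h₁b := h₁ .b2
    have h₁c := h₁ .c2
    have h₂b := h₂ .b2
    have h₂c := h₂ .c2
    have h₃c := h₃ .c2
    have h₄c := h₄ .c2
    simp only [b2_mem_dia, c2_mem_dia, ComplexAlgebra.mem_compl, ComplexAlgebra.mem_sup,
      hay, haz] at hb2 hc2 h₁b h₁c h₂b h₂c h₃c h₄c
    clear hfar hno h₁ h₂ h₃ h₄ hyz
    grind
  · -- the vertex `b₃` has no neighbour but `a`
    have h₁ := hfar ((y.or z).neg.diff y.dia) (fun t ht => by simp [separationProbes, ht])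
    have h₂ := hfar (y.diff ((y.or z).neg.and z.dia).dia)
      (fun t ht => by simp [separationProbes, ht])
    have haY : .a ∈ KTBAlgebra.dia (y.eval v) := a_mem_dia.2 (Or.inr (Or.inl hb))
    have hb3 : .b3 ∉ z.eval v := fun h =>
      haZ (a_mem_dia.2 (Or.inr (Or.inr (Or.inr (Or.inl h)))))
    simp only [eval_diff, eval_neg, eval_or, eval_dia, eval_and, ComplexAlgebra.mem_sdiff,
      ComplexAlgebra.mem_compl, ComplexAlgebra.mem_sup, ComplexAlgebra.mem_inf, b1_mem_dia,
      c1_mem_dia, d_mem_dia, haY, haZ, hay, haz, hb, hd, hcz, hcy, hbz, hdy, not_true_eq_false,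
      not_false_eq_true, or_true, and_true, or_false, and_false, false_and,
      forall_true_left] at h₁ h₂
    have h₁b := h₁ .b3
    have h₂b := h₂ .b3
    simp only [b3_mem_dia, ComplexAlgebra.mem_compl, ComplexAlgebra.mem_sup,
      ComplexAlgebra.mem_inf, hay, haz, haZ] at h₁b h₂b
    tauto

/-- The set `{d}` is definable from every set that has a nonempty interior and is not the whole
vertex set. -/
theorem exists_probe (hbox : KTBAlgebra.box (v 0) ≠ ⊥) (htop : v 0 ≠ ⊤) :
    ∃ t ∈ probes, t.eval v = setD N := by
  have hyz : ∀ w, w ∈ (var 0).neg.eval v → w ∉ KTBAlgebra.dia ((var 0).box.eval v) := by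
    intro w hw hw'
    rw [eval_neg, eval_var] at hw
    rw [eval_box, eval_var, ComplexAlgebra.mem_dia] at hw'
    obtain ⟨u, hu, h⟩ := hw'
    exact hw (ComplexAlgebra.mem_box.1 hu w (h.imp Eq.symm fun h => h.symm))
  have hzy : ∀ w, w ∈ (var 0).box.eval v → w ∉ KTBAlgebra.dia ((var 0).neg.eval v) := by
    intro w hw
    simpa [KTBAlgebra.box] using hw
  have hfar : ∀ s : ModalFormula, s.eval v ≠ ⊥ → (∀ t ∈ farProbes s, t ∈ probes) →
      (∃ t ∈ probes, t.eval v = setD N) ∨ .a ∈ s.eval v ∨ .b1 ∈ s.eval v ∨ .c1 ∈ s.eval v ∨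
        .d ∈ s.eval v := by
    intro s hs hs'
    by_contra hne
    push Not at hne
    refine hs (ComplexAlgebra.eq_bot_iff.2 fun w hw => ?_)
    obtain ⟨t, ht, heq⟩ := exists_farProbe hw hne.2.1 hne.2.2.1 hne.2.2.2.1 hne.2.2.2.2
    exact hne.1 t (hs' t ht) heq
  have hy := hfar (var 0).box (by simpa using hbox)
    (fun t ht => by simp [probes, separationProbes, ht])
  have hz := hfar (var 0).neg (by simpa using htop)
    (fun t ht => by simp [probes, separationProbes, ht])
  rcases hy with hy | hy
  · exact hy
  rcases hz with hz | hz
  · exact hz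
  have hprobes : ∀ t, t ∈ probes ↔ t ∈ separationProbes (var 0).box (var 0).neg ∨
      t ∈ separationProbes (var 0).neg (var 0).box := by simp [probes]
  by_cases hay : .a ∈ (var 0).box.eval v
  · have h := hyz .a; have h' := hyz .b1
    simp only [a_mem_dia, b1_mem_dia, hay] at h h'
    obtain ⟨t, ht, heq⟩ := exists_probe_of_a_mem hyz hay (by tauto)
    exact ⟨t, (hprobes t).2 (Or.inl ht), heq⟩
  by_cases haz : .a ∈ (var 0).neg.eval v
  · have h := hzy .a; have h' := hzy .b1
    simp only [a_mem_dia, b1_mem_dia, haz] at h h'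
    obtain ⟨t, ht, heq⟩ := exists_probe_of_a_mem hzy haz (by tauto)
    exact ⟨t, (hprobes t).2 (Or.inr ht), heq⟩
  have hb := hyz .b1
  have hc := hyz .c1
  have hd := hyz .d
  simp only [d_mem_dia, c1_mem_dia, b1_mem_dia] at hb hc hd
  by_cases hby : .b1 ∈ (var 0).box.eval v
  · have h : .d ∈ (var 0).neg.eval v := by
      clear hfar hprobes hyz hzy
      grind
    obtain ⟨t, ht, heq⟩ := exists_probe_of_a_notMem hyz hay haz hby h
    rw [List.mem_append] at ht
    exact ⟨t, (hprobes t).2 ht, heq⟩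
  · have h : .b1 ∈ (var 0).neg.eval v ∧ .d ∈ (var 0).box.eval v := by
      clear hfar hprobes hyz hzy
      grind
    obtain ⟨t, ht, heq⟩ := exists_probe_of_a_notMem hzy haz hay h.1 h.2
    rw [List.mem_append] at ht
    exact ⟨t, (hprobes t).2 ht.symm, heq⟩

end probes

/-! ### The algebras `D_N` -/

section algD

open ModalFormula

variable {N : Set ℕ}

/-- The generator `{d}` of `D_N`. -/
def genD (N : Set ℕ) : (algD N).carrier :=
  (⟨setD N, fun _ hS => hS rfl⟩ :
    (KTBSubalgebra.generate ({setD N} : Set (ComplexAlgebra (graphF N)))).toBooleanSubalgebra)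

/-- The inclusion of `D_N` into `Cm(F_N)`. -/
def inclD (N : Set ℕ) : BoundedLatticeHom (algD N).carrier (ComplexAlgebra (graphF N)) :=
  (KTBSubalgebra.generate
    ({setD N} : Set (ComplexAlgebra (graphF N)))).toBooleanSubalgebra.subtype

theorem isModalHom_inclD : IsModalHom (inclD N) := fun _ => rfl

theorem inclD_injective : Function.Injective (inclD N) := Subtype.val_injective

@[simp] theorem inclD_genD : inclD N (genD N) = setD N := rfl

theorem inclD_eq_top_iff {x : (algD N).carrier} : inclD N x = ⊤ ↔ x = ⊤ := by
  rw [← map_top (inclD N), inclD_injective.eq_iff]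

theorem exists_formula_algD (x : (algD N).carrier) :
    ∃ s : ModalFormula, ∀ v : ℕ → (algD N).carrier, v 0 = genD N → s.eval v = x := by
  obtain ⟨φ, -, h⟩ : ∃ (φ : ModalFormula) (_ : ℕ → Unit), φ.eval (fun _ => setD N) = inclD N x :=
    x.2 (termSubalgebra (α := ComplexAlgebra (graphF N)) fun _ : Unit => setD N)
      (Set.singleton_subset_iff.2 ⟨.var 0, fun _ => (), rfl⟩)
  refine ⟨φ.subst fun _ => .var 0, fun v hv => inclD_injective ?_⟩
  rw [isModalHom_inclD.map_eval, eval_subst]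
  simpa [hv] using h

theorem mem_logic_algD_of_valid {φ : ModalFormula}
    (h : ∀ v : ℕ → ComplexAlgebra (graphF N), φ.eval v = ⊤) :
    φ ∈ (KTBVariety.generatedBy {algD N}).logic :=
  mem_logic_generatedBy.2 fun v => inclD_eq_top_iff.1 <| by
    rw [isModalHom_inclD.map_eval]
    exact h _

theorem eval_setD_of_mem_logic_algD {φ : ModalFormula}
    (h : φ ∈ (KTBVariety.generatedBy {algD N}).logic) : φ.eval (fun _ => setD N) = ⊤ := by
  have := congrArg (inclD N) (mem_logic_generatedBy.1 h fun _ => genD N)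
  rwa [isModalHom_inclD.map_eval, map_top] at this

theorem mem_dia_setD {v : Vertex} : v ∈ KTBAlgebra.dia (setD N) ↔ v = .d ∨ v = .c1 := by
  cases v <;> simp [a_mem_dia, b1_mem_dia, b2_mem_dia, b3_mem_dia, c1_mem_dia, c2_mem_dia,
    d_mem_dia, l_mem_dia, u_mem_dia]

theorem mem_dia_dia_setD {v : Vertex} :
    v ∈ KTBAlgebra.dia (KTBAlgebra.dia (setD N)) ↔ v = .d ∨ v = .c1 ∨ v = .b1 := by
  cases v <;> simp [a_mem_dia, b1_mem_dia, b2_mem_dia, b3_mem_dia, c1_mem_dia, c2_mem_dia,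
    d_mem_dia, l_mem_dia, u_mem_dia]

theorem mem_dia_three_setD {v : Vertex} :
    v ∈ KTBAlgebra.dia (KTBAlgebra.dia (KTBAlgebra.dia (setD N))) ↔
      v = .d ∨ v = .c1 ∨ v = .b1 ∨ v = .a := by
  cases v <;> simp [a_mem_dia, b1_mem_dia, b2_mem_dia, b3_mem_dia, c1_mem_dia, c2_mem_dia,
    d_mem_dia, l_mem_dia, u_mem_dia]

theorem mem_dia_four_setD {v : Vertex} :
    v ∈ KTBAlgebra.dia (KTBAlgebra.dia (KTBAlgebra.dia (KTBAlgebra.dia (setD N)))) ↔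
      v ≠ .c2 ∧ ∀ j hj, v ≠ .u j hj := by
  cases v with
  | u j hj => simp [u_mem_dia, l_mem_dia, a_mem_dia, mem_dia_setD, hj]
  | _ => simp [a_mem_dia, b1_mem_dia, b2_mem_dia, b3_mem_dia, c1_mem_dia, c2_mem_dia,
      d_mem_dia, l_mem_dia]

/-- The set consisting of `a`, `c₁`, `c₂` and all `uᵢ` and its complement are both dense. -/
theorem CmK2_mem_generatedBy_algD : CmK2 ∈ (KTBVariety.generatedBy {algD N}).members := by
  let s : ModalFormula := (((var 0).dia.dia.dia.diff (var 0).dia.dia).or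
    ((var 0).dia.diff (var 0))).or (var 0).dia.dia.dia.dia.neg
  let X : ComplexAlgebra (graphF N) := s.eval fun _ => setD N
  have hX : ∀ v, v ∈ X ↔ v = .a ∨ v = .c1 ∨ v = .c2 ∨ ∃ j hj, v = .u j hj := by
    intro v
    simp only [X, s, eval_or, eval_diff, eval_dia, eval_var, eval_neg, ComplexAlgebra.mem_sup,
      ComplexAlgebra.mem_sdiff, ComplexAlgebra.mem_compl, mem_dia_setD, mem_dia_dia_setD,
      mem_dia_three_setD, mem_dia_four_setD, mem_setD]
    cases v <;> simp
  have hincl : inclD N (s.eval fun _ => genD N) = X := isModalHom_inclD.map_eval _ _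
  refine CmK2_mem_generatedBy (x := s.eval fun _ => genD N) ?_ ?_ fun h => ?_
  · rw [← inclD_eq_top_iff, isModalHom_inclD, hincl, ComplexAlgebra.eq_top_iff]
    intro v
    cases v with
    | u j hj => simp [u_mem_dia, hX, hj]
    | _ => simp [a_mem_dia, b1_mem_dia, b2_mem_dia, b3_mem_dia, c1_mem_dia, c2_mem_dia,
        d_mem_dia, l_mem_dia, hX]
  · rw [← inclD_eq_top_iff, isModalHom_inclD, map_compl', hincl, ComplexAlgebra.eq_top_iff]
    intro v
    cases v with
    | u j hj => exact u_mem_dia.2 (Or.inr ⟨j, by simp [hX], Or.inl rfl⟩)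
    | _ => simp [a_mem_dia, b1_mem_dia, b2_mem_dia, b3_mem_dia, c1_mem_dia, c2_mem_dia,
        d_mem_dia, l_mem_dia, hX]
  · have := congrArg (inclD N) h
    rw [map_bot, map_top] at this
    exact ComplexAlgebra.eq_top_iff.1 this .a

theorem algD_notMem_generatedBy_CmK2 : algD N ∉ (KTBVariety.generatedBy {CmK2}).members := by
  intro h
  have hmem : ((var 0).dia.dia.imp (var 0).dia) ∈ (KTBVariety.generatedBy {CmK2}).logic :=
    mem_logic_generatedBy_Cm.2 fun (v : ℕ → AlgK2) => by
      rw [eval_imp_eq_top]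
      intro i hi
      rw [eval_dia, eval_dia] at hi
      rw [eval_dia]
      change i ∈ KTBAlgebra.dia (KTBAlgebra.dia (v 0)) at hi
      change i ∈ KTBAlgebra.dia (v 0)
      simp only [AlgK2.mem_dia] at hi ⊢
      tauto
  have hle := eval_setD_of_mem_logic_algD
    (KTBVariety.logic_anti (KTBVariety.generatedBy_le.2 (Set.singleton_subset_iff.2 h)) hmem)
  rw [eval_imp_eq_top, eval_dia, eval_dia] at hle
  have hb : .b1 ∈ KTBAlgebra.dia (setD N) :=
    hle (mem_dia_dia_setD.2 (by simp))
  simp [mem_dia_setD] at hb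

end algD

/-! ### The covering property -/

namespace ModalFormula

/-- The conjunction of `□⁵ψ(t(φ))` over the probes `t`. -/
def probeGuard (ψ φ : ModalFormula) : ModalFormula :=
  (probes.map fun t => box^[5] (ψ.subst fun _ => t.subst fun _ => φ)).foldr and top

theorem eval_foldr_and_le {α : Type} [KTBAlgebra α] {v : ℕ → α} {l : List ModalFormula}
    {φ : ModalFormula} (h : φ ∈ l) : (l.foldr and top).eval v ≤ φ.eval v := by
  induction l with
  | nil => simp at h
  | cons χ l ih =>
    rw [List.foldr_cons, eval_and]
    rcases List.mem_cons.1 h with rfl | h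
    · exact inf_le_left
    · exact inf_le_right.trans (ih h)

theorem eval_foldr_and_eq_top {α : Type} [KTBAlgebra α] {v : ℕ → α} {l : List ModalFormula}
    (h : ∀ φ ∈ l, φ.eval v = ⊤) : (l.foldr and top).eval v = ⊤ := by
  induction l with
  | nil => simp
  | cons χ l ih =>
    rw [List.foldr_cons, eval_and, h χ (by simp), ih fun φ hφ => h φ (by simp [hφ]), inf_top_eq]

theorem eval_box_iterate {α : Type} [KTBAlgebra α] (v : ℕ → α) (n : ℕ) (φ : ModalFormula) :
    (box^[n] φ).eval v = KTBAlgebra.box^[n] (φ.eval v) :=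
  Function.Semiconj.iterate_right (f := eval v) (fun φ => eval_box v φ) n φ

theorem eval_probeGuard_eq_top {V : KTBVariety} {ψ : ModalFormula} (hψ : ψ ∈ V.logic)
    (φ : ModalFormula) {A : KTBAlg} (hA : A ∈ V.members) (v : ℕ → A.carrier) :
    (probeGuard ψ φ).eval v = ⊤ := by
  refine eval_foldr_and_eq_top fun χ hχ => ?_
  obtain ⟨t, -, rfl⟩ := List.mem_map.1 hχ
  rw [eval_box_iterate, eval_subst, hψ A hA]
  exact Function.iterate_fixed KTBAlgebra.box_top 5

theorem eval_probeGuard_eq_bot {N : Set ℕ} {ψ φ : ModalFormula}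
    {v : ℕ → ComplexAlgebra (graphF N)} (hψ : ψ.eval (fun _ => setD N) ≠ ⊤)
    (hbox : KTBAlgebra.box (φ.eval v) ≠ ⊥) (htop : φ.eval v ≠ ⊤) :
    (probeGuard ψ φ).eval v = ⊥ := by
  obtain ⟨t, ht, heq⟩ := exists_probe (v := fun _ => φ.eval v) hbox htop
  refine le_bot_iff.1 ((eval_foldr_and_le (List.mem_map.2 ⟨t, ht, rfl⟩)).trans (le_bot_iff.2 ?_))
  have hdual : ∀ (n : ℕ) (X : ComplexAlgebra (graphF N)),
      KTBAlgebra.box^[n] X = (KTBAlgebra.dia^[n] Xᶜ)ᶜ := fun n => by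
    induction n with
    | zero => simp
    | succ n ih =>
      intro X
      rw [Function.iterate_succ_apply', Function.iterate_succ_apply', ih, KTBAlgebra.box,
        compl_compl]
  simp only [eval_box_iterate, eval_subst, heq]
  rw [hdual, dia_iterate_five_eq_top (fun h => hψ (compl_eq_bot.1 h)), compl_top]

end ModalFormula

open ModalFormula in
theorem le_generatedBy_CmK2_of_algD_notMem {N : Set ℕ} {V : KTBVariety}
    (hV : V ≤ KTBVariety.generatedBy {algD N}) (hD : algD N ∉ V.members) :
    V ≤ KTBVariety.generatedBy {CmK2} := by
  obtain ⟨ψ, hψ, href⟩ := KTBVariety.exists_refuted_at_generator exists_formula_algD hD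
  have hψD : ψ.eval (fun _ => setD N) ≠ ⊤ := fun h => href (fun _ => genD N) rfl <| by
    rw [← inclD_eq_top_iff, isModalHom_inclD.map_eval]
    exact h
  refine fun A hA => mem_generatedBy_CmK2 (fun x => ?_) fun e y => ?_
  · have h : (probeGuard ψ (var 0)).imp ((var 0).box.imp (var 0).box.box) ∈
        (KTBVariety.generatedBy {algD N}).logic := mem_logic_algD_of_valid fun v => by
      rw [eval_imp_eq_top]
      by_cases hbox : KTBAlgebra.box (v 0) = ⊥
      · simp [hbox]
      by_cases htop : v 0 = ⊤
      · simp [htop]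
      rw [eval_probeGuard_eq_bot (φ := var 0) hψD hbox htop]
      exact bot_le
    have h' := (eval_imp_eq_top _ _ _).1 (h A (hV hA) fun _ => xᶜ)
    rw [eval_probeGuard_eq_top hψ _ hA, top_le_iff, eval_imp_eq_top] at h'
    have := compl_le_compl h'
    simpa [KTBAlgebra.box] using this
  · let p : ModalFormula := (var 1).diff (var 0)
    let q : ModalFormula := (var 1).neg.diff (var 0)
    have h : ((probeGuard ψ (var 0).neg).and ((probeGuard ψ p.neg).and (probeGuard ψ q.neg))).imp
        ((var 0).and (p.dia.and q.dia)).neg ∈ (KTBVariety.generatedBy {algD N}).logic :=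
      mem_logic_algD_of_valid fun v => by
        rw [eval_imp_eq_top]
        have key : ∀ φ : ModalFormula, φ.eval v ≠ ⊥ → .b3 ∉ KTBAlgebra.dia (φ.eval v) →
            (probeGuard ψ φ.neg).eval v = ⊥ := fun φ hne hb => by
          refine eval_probeGuard_eq_bot hψD (fun h => ?_) fun h => ?_
          · refine ComplexAlgebra.eq_bot_iff.1 h .b3 ?_
            simpa [KTBAlgebra.box] using hb
          · exact hne (by simpa using h)
        by_cases h0 : (var 0).eval v = ⊥
        · simp [show v 0 = ⊥ from h0]
        by_cases hp : p.eval v = ⊥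
        · simp only [eval_neg, eval_and, eval_dia, hp, KTBAlgebra.dia_bot]; simp
        by_cases hq : q.eval v = ⊥
        · simp only [eval_neg, eval_and, eval_dia, hq, KTBAlgebra.dia_bot]; simp
        -- three disjoint sets cannot all meet the closed neighbourhood `{a, b₃}` of `b₃`
        have hb : .b3 ∉ KTBAlgebra.dia ((var 0).eval v) ∨ .b3 ∉ KTBAlgebra.dia (p.eval v) ∨
            .b3 ∉ KTBAlgebra.dia (q.eval v) := by
          simp only [p, q, b3_mem_dia, eval_diff, eval_neg, ComplexAlgebra.mem_sdiff,
            ComplexAlgebra.mem_compl]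
          tauto
        rcases hb with hb | hb | hb
        · simp [key _ h0 hb]
        · simp [key _ hp hb]
        · simp [key _ hq hb]
    have h' := (eval_imp_eq_top _ _ _).1
      (h A (hV hA) fun n => if n = 0 then e else y)
    rw [eval_and, eval_and, eval_probeGuard_eq_top hψ _ hA, eval_probeGuard_eq_top hψ _ hA,
      eval_probeGuard_eq_top hψ _ hA, top_inf_eq, top_inf_eq, top_le_iff,
      eval_neg, compl_eq_top] at h'
    simpa [p, q] using h'

theorem generatedBy_CmK2_covBy (N : Set ℕ) :
    KTBVariety.generatedBy {CmK2} ⋖ KTBVariety.generatedBy {algD N} :=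
  KTBVariety.covBy_generatedBy
    (KTBVariety.generatedBy_le.2 (Set.singleton_subset_iff.2 CmK2_mem_generatedBy_algD))
    algD_notMem_generatedBy_CmK2 fun _ => le_generatedBy_CmK2_of_algD_notMem

/-! ### Recovering `N` from the logic of `D_N` -/

namespace ModalFormula

/-- At `p₀ = {d}`, the set `{c₂, u₁, u₂, …}` of the vertices farthest from `d`. -/
def upper : ModalFormula := (var 0).dia.dia.dia.dia.neg

/-- At `p₀ = {d}`, the set `{b₂, b₃, l₀, l₁, …}` of the vertices at distance four from `d`. -/
def fourthSphere : ModalFormula := (var 0).dia.dia.dia.dia.diff (var 0).dia.dia.dia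

/-- At `p₀ = {d}`, the set `{b₂, l₁, l₂, …}` of the vertices at distance four from `d` that have a
neighbour at distance five. -/
def lower : ModalFormula := fourthSphere.and upper.dia

/-- At `p₀ = {d}`, the set `{l₁}`: of the vertices at distance four from `d`, all but `b₃` and
`l₀` have a neighbour at distance five, and of these `l₁` is the only one adjacent to `b₃` or
`l₀`. -/
def lowerOne : ModalFormula := lower.and (fourthSphere.diff upper.dia).dia

/-- The set of the vertices `lᵢ` adjacent to some vertex of `s`, a finite set of vertices `uⱼ`. -/
def lowerNeighbors (s : ModalFormula) : ModalFormula := lower.and s.dia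

/-- The set of the vertices `uⱼ` adjacent to some vertex of `s`, a finite set of vertices `lᵢ`. -/
def upperNeighbors (s : ModalFormula) : ModalFormula := upper.and s.dia

open Classical in
/-- At `p₀ = {d}` in `F_N`, the set of the vertices `uⱼ` with `1 ≤ j ≤ 2 * k + 1`. -/
noncomputable def upperSegment (N : Set ℕ) : ℕ → ModalFormula
  | 0 => upperNeighbors lowerOne
  | k + 1 =>
    let s := upperNeighbors (lowerNeighbors (upperSegment N k))
    if 2 * k + 2 ∈ N then s else upperNeighbors (lowerNeighbors s)

/-- The set of those new neighbours of `l₁, …, l₂ₖ₊₂` that are not adjacent to a further `lᵢ`: it is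
`{u₂ₖ₊₂}` or empty according to whether `2 * k + 2` belongs to `N`. -/
noncomputable def membershipTest (N : Set ℕ) (k : ℕ) : ModalFormula :=
  ((upperNeighbors (lowerNeighbors (upperSegment N k))).diff (upperSegment N k)).diff
    (lower.diff (lowerNeighbors (upperSegment N k))).dia

/-- A formula that fails at `{d}` if and only if the membership test is nonempty there, and that
has the value `⊤` at every other set. -/
noncomputable def membershipFormula (N : Set ℕ) (k : ℕ) : ModalFormula :=
  (lowerOne.and (dia^[5] (membershipTest N k))).neg

theorem upperSegment_congr {N M : Set ℕ} {k : ℕ}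
    (h : ∀ j < k, (2 * j + 2 ∈ N ↔ 2 * j + 2 ∈ M)) : upperSegment N k = upperSegment M k := by
  induction k with
  | zero => rfl
  | succ k ih =>
    have hk := h k k.lt_succ_self
    rw [upperSegment, upperSegment, ih fun j hj => h j (hj.trans k.lt_succ_self)]
    by_cases hM : 2 * k + 2 ∈ M
    · rw [if_pos hM, if_pos (hk.2 hM)]
    · rw [if_neg hM, if_neg (mt hk.1 hM)]

theorem eval_dia_iterate {α : Type} [KTBAlgebra α] (v : ℕ → α) (n : ℕ) (φ : ModalFormula) :
    (dia^[n] φ).eval v = KTBAlgebra.dia^[n] (φ.eval v) :=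
  Function.Semiconj.iterate_right (f := eval v) (fun φ => eval_dia v φ) n φ

end ModalFormula

section recover

open ModalFormula

variable {N : Set ℕ} {v : ℕ → ComplexAlgebra (graphF N)}

/-- The term for `{l₁}` has an empty value at every set other than `{d}`: all vertices but `d` are
within distance four of a nonempty set other than `{d}`, and the vertices next to `d` do not satisfy
the description of `l₁`. -/
theorem eval_lowerOne_of_ne (hv : v 0 ≠ setD N) : lowerOne.eval v = ⊥ := by
  rw [ComplexAlgebra.eq_bot_iff]
  intro w hw
  simp only [lowerOne, lower, fourthSphere, upper, eval_and, eval_diff, eval_neg, eval_dia,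
    eval_var, ComplexAlgebra.mem_inf, ComplexAlgebra.mem_sdiff] at hw
  obtain ⟨⟨⟨hw4, hw3⟩, hwE⟩, hwo⟩ := hw
  by_cases hx : ∃ x ∈ v 0, x ≠ .d
  · obtain ⟨x, hx, hxd⟩ := hx
    have ha := a_mem_dia_dia hx hxd
    -- only `d` can be at distance five, so that the vertices next to it are `d` and `c₁`
    obtain ⟨e, he, hwe⟩ := mem_dia_graphF.1 hwE
    have hed : e = .d := by
      by_contra hed
      exact he (mem_dia_dia_of_a_mem ha hed)
    subst hed
    have hw' : w = .c1 := by
      rcases hwe with rfl | h | h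
      · exact (he hw4).elim
      · cases h; rfl
      · cases h
    subst hw'
    rcases c1_mem_dia.1 hwo with h | h | h
    · exact h.2 hwE
    · exact h.2 (KTBAlgebra.le_dia (α := ComplexAlgebra (graphF N)) _ he)
    · exact h.1.2 (b1_mem_dia.2 (Or.inr (Or.inr ha)))
  · push Not at hx
    have hbot : v 0 = ⊥ := by
      rw [ComplexAlgebra.eq_bot_iff]
      intro x hxv
      obtain rfl := hx x hxv
      exact hv (eq_setD_iff.2 ⟨hxv, fun y hy hy' => hy (hx y hy')⟩)
    simp [hbot, KTBAlgebra.dia_bot] at hw4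

section generator

variable (hv : v 0 = setD N)
include hv

theorem mem_upper {w : Vertex} : w ∈ upper.eval v ↔ w = .c2 ∨ ∃ j hj, w = .u j hj := by
  simp only [upper, eval_neg, eval_dia, eval_var, hv, ComplexAlgebra.mem_compl, mem_dia_four_setD]
  cases w with
  | u j hj => simp [hj]
  | _ => simp

theorem mem_fourthSphere {w : Vertex} :
    w ∈ fourthSphere.eval v ↔ w = .b2 ∨ w = .b3 ∨ ∃ i, w = .l i := by
  simp only [fourthSphere, eval_diff, eval_dia, eval_var, hv, ComplexAlgebra.mem_sdiff,
    mem_dia_four_setD, mem_dia_three_setD]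
  cases w with
  | u j hj => simp [hj]
  | _ => simp

theorem mem_upperNeighbors {s : ModalFormula} {P : ℕ → Prop}
    (hs : ∀ w, w ∈ s.eval v ↔ ∃ i, i ≠ 0 ∧ w = .l i ∧ P i) (w : Vertex) :
    w ∈ (upperNeighbors s).eval v ↔
      ∃ j, ∃ hj : j ≠ 0, w = .u j hj ∧ ∃ i, i ≠ 0 ∧ P i ∧ LAdjU N i j := by
  simp only [upperNeighbors, eval_and, eval_dia, ComplexAlgebra.mem_inf, mem_upper hv]
  constructor
  · rintro ⟨rfl | ⟨j, hj, rfl⟩, h⟩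
    · simp [c2_mem_dia, hs] at h
    · refine ⟨j, hj, rfl, ?_⟩
      simp only [u_mem_dia, hs] at h
      rcases h with ⟨_, _, h, _⟩ | ⟨i, ⟨i', hi, h, hP⟩, hadj⟩
      all_goals cases h
      exact ⟨i, hi, hP, hadj⟩
  · rintro ⟨j, hj, rfl, i, hi, hP, hadj⟩
    exact ⟨Or.inr ⟨j, hj, rfl⟩, u_mem_dia.2 (Or.inr ⟨i, (hs _).2 ⟨i, hi, rfl, hP⟩, hadj⟩)⟩

variable (hN : N ⊆ posEven)
include hN

theorem mem_dia_upper {i : ℕ} : .l i ∈ KTBAlgebra.dia (upper.eval v) ↔ i ≠ 0 := by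
  rw [l_mem_dia]
  simp only [mem_upper hv]
  constructor
  · rintro (h | h | ⟨-, h⟩ | ⟨-, h⟩ | ⟨j, hj, -, h⟩)
    any_goals simp at h
    simp only [LAdjU, posEven, Set.mem_ofPred_eq] at h
    rcases h with h | h | h | h
    · omega
    · omega
    · exact (hN h.1).1.ne'
    · omega
  · intro hi
    exact Or.inr <| Or.inr <| Or.inr <| Or.inr ⟨i, hi, by simp [hi], Or.inl rfl⟩

theorem mem_lower {w : Vertex} : w ∈ lower.eval v ↔ w = .b2 ∨ ∃ i, i ≠ 0 ∧ w = .l i := by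
  simp only [lower, eval_and, eval_dia, ComplexAlgebra.mem_inf, mem_fourthSphere hv]
  cases w with
  | l i => simp [mem_dia_upper hv hN]
  | _ => simp [b2_mem_dia, b3_mem_dia, mem_upper hv]

theorem mem_lowerOne {w : Vertex} : w ∈ lowerOne.eval v ↔ w = .l 1 := by
  have h : ∀ w, w ∈ (fourthSphere.diff upper.dia).eval v ↔ w = .b3 ∨ w = .l 0 := fun w => by
    simp only [eval_diff, eval_dia, ComplexAlgebra.mem_sdiff, mem_fourthSphere hv]
    cases w with
    | l i => simp [mem_dia_upper hv hN]
    | _ => simp [b2_mem_dia, b3_mem_dia, mem_upper hv]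
  simp only [lowerOne, eval_and, eval_dia, ComplexAlgebra.mem_inf, mem_lower hv hN]
  cases w with
  | l i =>
    rw [l_mem_dia]
    simp only [h]
    simp
    omega
  | b2 =>
    rw [b2_mem_dia]
    simp [-eval_diff, h]
  | _ => simp

theorem mem_lowerNeighbors {s : ModalFormula} {P : ℕ → Prop}
    (hs : ∀ w, w ∈ s.eval v ↔ ∃ j hj, w = .u j hj ∧ P j) (w : Vertex) :
    w ∈ (lowerNeighbors s).eval v ↔
      ∃ i, i ≠ 0 ∧ w = .l i ∧ ∃ j, j ≠ 0 ∧ P j ∧ LAdjU N i j := by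
  simp only [lowerNeighbors, eval_and, eval_dia, ComplexAlgebra.mem_inf, mem_lower hv hN]
  constructor
  · rintro ⟨rfl | ⟨i, hi, rfl⟩, h⟩
    · simp [b2_mem_dia, hs] at h
    · refine ⟨i, hi, rfl, ?_⟩
      simp only [l_mem_dia, hs] at h
      rcases h with ⟨_, _, h, _⟩ | ⟨_, _, h, _⟩ | ⟨_, _, _, h, _⟩ | ⟨_, _, _, h, _⟩ |
        ⟨j, hj, ⟨j', _, h, hP⟩, hadj⟩
      any_goals cases h
      exact ⟨j, hj, hP, hadj⟩
  · rintro ⟨i, hi, rfl, j, hj, hP, hadj⟩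
    exact ⟨Or.inr ⟨i, hi, rfl⟩, l_mem_dia.2 <| Or.inr <| Or.inr <| Or.inr <| Or.inr
      ⟨j, hj, (hs _).2 ⟨j, hj, rfl, hP⟩, hadj⟩⟩

/-- The neighbours of `l₁, …, l₂ₖ₊₂` are `u₁, …, u₂ₖ₊₂` and, if `2 * k + 2` belongs to `N`,
also `u₂ₖ₊₃`. -/
theorem mem_upperNeighbors_lowerNeighbors {s : ModalFormula} {k : ℕ}
    (hs : ∀ w, w ∈ s.eval v ↔ ∃ j hj, w = .u j hj ∧ j ≤ 2 * k + 1) :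
    (∀ w, w ∈ (lowerNeighbors s).eval v ↔ ∃ i, i ≠ 0 ∧ w = .l i ∧ i ≤ 2 * k + 2) ∧
    ∀ w, w ∈ (upperNeighbors (lowerNeighbors s)).eval v ↔
      ∃ j hj, w = .u j hj ∧ (j ≤ 2 * k + 2 ∨ (j = 2 * k + 3 ∧ 2 * k + 2 ∈ N)) := by
  have hl : ∀ w, w ∈ (lowerNeighbors s).eval v ↔ ∃ i, i ≠ 0 ∧ w = .l i ∧ i ≤ 2 * k + 2 := by
    intro w
    rw [mem_lowerNeighbors hv hN hs]
    refine exists_congr fun i => and_congr_right fun hi => and_congr_right fun _ => ?_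
    constructor
    · rintro ⟨j, hj, hjk, rfl | ⟨-, h⟩ | ⟨-, h⟩ | ⟨-, h⟩⟩ <;> omega
    · intro h
      by_cases h' : i = 2 * k + 2
      · exact ⟨2 * k + 1, by omega, le_rfl, Or.inr (Or.inl ⟨by
          rw [h', posEven, Set.mem_ofPred_eq, Nat.even_iff]; omega, h'⟩)⟩
      · exact ⟨i, hi, by omega, Or.inl rfl⟩
  refine ⟨hl, fun w => ?_⟩
  rw [mem_upperNeighbors hv hl]
  refine exists_congr fun j => exists_congr fun hj => and_congr_right fun _ => ?_
  constructor
  · rintro ⟨i, hi, hik, rfl | ⟨-, h⟩ | ⟨hN, h⟩ | ⟨-, h⟩⟩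
    · omega
    · omega
    · by_cases h' : i = 2 * k + 2
      · exact Or.inr ⟨by omega, h' ▸ hN⟩
      · omega
    · omega
  · rintro (h | ⟨h, hN⟩)
    · exact ⟨j, hj, h, Or.inl rfl⟩
    · exact ⟨2 * k + 2, by omega, le_rfl, Or.inr (Or.inr (Or.inl ⟨hN, h⟩))⟩

theorem mem_upperSegment (k : ℕ) (w : Vertex) : w ∈ (upperSegment N k).eval v ↔
    ∃ j hj, w = .u j hj ∧ j ≤ 2 * k + 1 := by
  induction k generalizing w with
  | zero =>
    rw [upperSegment, mem_upperNeighbors hv (P := fun i => i = 1)]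
    · refine exists_congr fun j => exists_congr fun hj => and_congr_right fun _ => ?_
      constructor
      · rintro ⟨i, hi, rfl, rfl | ⟨-, h⟩ | ⟨h, -⟩ | ⟨-, h⟩⟩
        · omega
        · omega
        · have := Nat.even_iff.1 (hN h).2
          omega
        · omega
      · exact fun h => ⟨1, one_ne_zero, rfl, Or.inl (by omega)⟩
    · intro w
      rw [mem_lowerOne hv hN]
      constructor
      · rintro rfl; exact ⟨1, one_ne_zero, rfl, rfl⟩
      · rintro ⟨i, -, rfl, rfl⟩; rfl
  | succ k ih =>
    obtain ⟨hl, hu⟩ := mem_upperNeighbors_lowerNeighbors hv hN ih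
    rw [upperSegment]
    by_cases hk : 2 * k + 2 ∈ N
    · rw [if_pos hk, hu]
      refine exists_congr fun j => exists_congr fun hj => and_congr_right fun _ => ?_
      simp only [hk, and_true]
      omega
    · simp only [hk, and_false, or_false] at hu
      rw [if_neg hk, mem_upperNeighbors hv (mem_lowerNeighbors hv hN hu)]
      refine exists_congr fun j => exists_congr fun hj => and_congr_right fun _ => ?_
      have heven : 2 * k + 2 ∈ posEven := ⟨by omega, k + 1, by omega⟩
      constructor
      · rintro ⟨i, hi, ⟨j', hj', hjk, h⟩, h'⟩
        have hik : i ≤ 2 * k + 3 := by rcases h with h | ⟨-, h⟩ | ⟨-, h⟩ | ⟨-, h⟩ <;> omega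
        rcases h' with h' | ⟨-, h'⟩ | ⟨hiN, h'⟩ | ⟨-, h'⟩
        · omega
        · omega
        · have := Nat.even_iff.1 (hN hiN).2
          omega
        · omega
      · intro h
        refine ⟨j, hj, ?_, Or.inl rfl⟩
        by_cases h' : j = 2 * k + 3
        · exact ⟨2 * k + 2, by omega, le_rfl, Or.inr (Or.inr (Or.inr ⟨⟨heven, hk⟩, h'⟩))⟩
        · exact ⟨j, hj, by omega, Or.inl rfl⟩

theorem mem_membershipTest {k : ℕ} {w : Vertex} : w ∈ (membershipTest N k).eval v ↔
    w = .u (2 * k + 2) (by omega) ∧ 2 * k + 2 ∈ N := by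
  obtain ⟨hl, hu⟩ := mem_upperNeighbors_lowerNeighbors hv hN (mem_upperSegment hv hN k)
  have hrest : ∀ j hj, .u j hj ∈ KTBAlgebra.dia
      ((lower.diff (lowerNeighbors (upperSegment N k))).eval v) ↔
      ∃ i, 2 * k + 2 < i ∧ LAdjU N i j := by
    intro j hj
    simp only [u_mem_dia, eval_diff, ComplexAlgebra.mem_sdiff, mem_lower hv hN, hl]
    constructor
    · rintro (⟨h | ⟨_, _, h⟩, _⟩ | ⟨i, ⟨h | ⟨i', hi, h⟩, hk⟩, hadj⟩)
      all_goals cases h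
      exact ⟨i, not_le.1 fun h => hk ⟨i, hi, rfl, h⟩, hadj⟩
    · rintro ⟨i, hik, hadj⟩
      refine Or.inr ⟨i, ⟨Or.inr ⟨i, by omega, rfl⟩, ?_⟩, hadj⟩
      rintro ⟨i', -, h, hik'⟩
      cases h
      omega
  rw [membershipTest, eval_diff, eval_diff, ComplexAlgebra.mem_sdiff, ComplexAlgebra.mem_sdiff, hu,
    mem_upperSegment hv hN, eval_dia]
  constructor
  · rintro ⟨⟨⟨j, hj, rfl, h⟩, hs⟩, h'⟩
    rw [hrest] at h'
    have hjk : 2 * k + 2 ≤ j := not_lt.1 fun h => hs ⟨j, hj, rfl, by omega⟩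
    have hj' : j = 2 * k + 2 := by
      by_contra hne
      exact h' ⟨j, by omega, Or.inl rfl⟩
    subst hj'
    refine ⟨rfl, by_contra fun hk => h' ⟨2 * k + 3, by omega, Or.inr (Or.inr (Or.inr ?_))⟩⟩
    exact ⟨⟨⟨by omega, k + 1, by omega⟩, hk⟩, rfl⟩
  · rintro ⟨rfl, hk⟩
    refine ⟨⟨⟨_, _, rfl, Or.inl le_rfl⟩, ?_⟩, ?_⟩
    · rintro ⟨j, hj, h, hjk⟩
      cases h
      omega
    · rw [hrest]
      rintro ⟨i, hik, h | ⟨h, h'⟩ | ⟨-, h⟩ | ⟨h, -⟩⟩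
      · omega
      · have := Nat.even_iff.1 h.2
        omega
      · omega
      · exact h.2 hk

end generator

end recover

open ModalFormula in
theorem membershipFormula_mem_logic {N : Set ℕ} (hN : N ⊆ posEven) {k : ℕ}
    (hk : 2 * k + 2 ∉ N) :
    membershipFormula N k ∈ (KTBVariety.generatedBy {algD N}).logic := by
  refine mem_logic_algD_of_valid fun v => ?_
  rw [membershipFormula, eval_neg, eval_and, compl_eq_top]
  by_cases hv : v 0 = setD N
  · have : (membershipTest N k).eval v = ⊥ :=
      ComplexAlgebra.eq_bot_iff.2 fun w hw => hk ((mem_membershipTest hv hN).1 hw).2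
    rw [eval_dia_iterate, this, Function.iterate_fixed KTBAlgebra.dia_bot, inf_bot_eq]
  · rw [eval_lowerOne_of_ne hv, bot_inf_eq]

open ModalFormula in
theorem membershipFormula_notMem_logic {N : Set ℕ} (hN : N ⊆ posEven) {k : ℕ}
    (hk : 2 * k + 2 ∈ N) :
    membershipFormula N k ∉ (KTBVariety.generatedBy {algD N}).logic := by
  intro h
  have h' := eval_setD_of_mem_logic_algD h
  have hne : (membershipTest N k).eval (fun _ => setD N) ≠ ⊥ := fun hbot =>
    ComplexAlgebra.eq_bot_iff.1 hbot _ ((mem_membershipTest rfl hN).2 ⟨rfl, hk⟩)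
  rw [membershipFormula, eval_neg, eval_and, compl_eq_top, eval_dia_iterate,
    dia_iterate_five_eq_top hne, inf_top_eq] at h'
  exact ComplexAlgebra.eq_bot_iff.1 h' _ ((mem_lowerOne rfl hN).2 rfl)

/-- The formula for the least number on which two sets differ tells the logics apart, since its
subformulas for the segments below that number are the same for both sets. -/
theorem injOn_logic_algD :
    Set.InjOn (fun N : Set ℕ => (KTBVariety.generatedBy {algD N}).logic) {N | N ⊆ posEven} := by
  classical
  intro N hN M hM heq
  by_contra hne
  have hex : ∃ k, ¬ (2 * k + 2 ∈ N ↔ 2 * k + 2 ∈ M) := by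
    by_contra hall
    push Not at hall
    refine hne (Set.ext fun n => ?_)
    by_cases hn : n ∈ posEven
    · obtain ⟨m, hm⟩ := hn.2
      have hpos := hn.1
      obtain rfl : n = 2 * (m - 1) + 2 := by omega
      exact hall (m - 1)
    · exact iff_of_false (fun h => hn (hN h)) fun h => hn (hM h)
  have hmin : ∀ j < Nat.find hex, (2 * j + 2 ∈ N ↔ 2 * j + 2 ∈ M) := fun j hj =>
    not_not.1 (Nat.find_min hex hj)
  have hform : ModalFormula.membershipFormula N (Nat.find hex) =
      ModalFormula.membershipFormula M (Nat.find hex) := by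
    rw [ModalFormula.membershipFormula, ModalFormula.membershipTest,
      ModalFormula.upperSegment_congr hmin]
    rfl
  change (KTBVariety.generatedBy {algD N}).logic = (KTBVariety.generatedBy {algD M}).logic at heq
  have hspec := Nat.find_spec hex
  by_cases h : 2 * Nat.find hex + 2 ∈ N
  · have hM' : 2 * Nat.find hex + 2 ∉ M := by tauto
    refine membershipFormula_notMem_logic hN h ?_
    rw [heq, hform]
    exact membershipFormula_mem_logic hM hM'
  · have hM' : 2 * Nat.find hex + 2 ∈ M := by tauto
    refine membershipFormula_notMem_logic hM hM' ?_
    rw [← heq, ← hform]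
    exact membershipFormula_mem_logic hN h

/-! ### Cardinalities -/

/-- A Gödel numbering of the modal formulas. -/
def ModalFormula.code : ModalFormula → ℕ
  | var n => Nat.pair 0 n
  | bot => Nat.pair 1 0
  | imp φ ψ => Nat.pair 2 (Nat.pair φ.code ψ.code)
  | box φ => Nat.pair 3 φ.code

theorem ModalFormula.code_injective : Function.Injective ModalFormula.code := by
  intro φ
  induction φ with
  | var n => intro ψ h; cases ψ <;> simp [code] at h ⊢; exact h
  | bot => intro ψ h; cases ψ <;> simp [code] at h ⊢
  | imp φ χ h₁ h₂ =>
    intro ψ h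
    cases ψ <;> simp [code] at h ⊢
    exact ⟨h₁ h.1, h₂ h.2⟩
  | box φ h₁ =>
    intro ψ h
    cases ψ <;> simp [code] at h ⊢
    exact h₁ h

instance : Countable ModalFormula := ModalFormula.code_injective.countable

theorem mk_set_modalFormula_le : Cardinal.mk (Set ModalFormula) ≤ Cardinal.continuum := by
  rw [Cardinal.mk_set, ← Cardinal.two_power_aleph0]
  exact Cardinal.power_le_power_left two_ne_zero Cardinal.mk_le_aleph0

theorem continuum_le_mk_subset_posEven :
    Cardinal.continuum ≤ Cardinal.mk {N : Set ℕ // N ⊆ posEven} := by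
  rw [← Cardinal.two_power_aleph0, ← Cardinal.mk_nat, ← Cardinal.mk_set]
  have hinj : Function.Injective fun n : ℕ => 2 * n + 2 := fun a b h => by
    simp only at h
    omega
  refine Cardinal.mk_le_of_injective (f := fun S : Set ℕ =>
    (⟨(fun n => 2 * n + 2) '' S, ?_⟩ : {N : Set ℕ // N ⊆ posEven})) fun S T h => ?_
  · rintro _ ⟨n, -, rfl⟩
    exact ⟨by simp, n + 1, by ring⟩
  · exact hinj.image_injective (congrArg Subtype.val h)

theorem hasCodimension_three_toNExt_algD (N : Set ℕ) :
    HasCodimension 3 (KTBVariety.generatedBy {algD N}).toNExt := by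
  refine ⟨![⊤, (KTBVariety.generatedBy {CmK1}).toNExt, (KTBVariety.generatedBy {CmK2}).toNExt,
    (KTBVariety.generatedBy {algD N}).toNExt], rfl, rfl, fun i => ?_⟩
  fin_cases i
  · exact toNExt_trivialVariety ▸ KTBVariety.toNExt_covBy trivialVariety_covBy
  · exact KTBVariety.toNExt_covBy generatedBy_CmK1_covBy
  · exact KTBVariety.toNExt_covBy (generatedBy_CmK2_covBy N)

theorem mainTheorem1 :
    -- the logics of codimension 3 in NExt(KTB) form a set of cardinality continuum
    Cardinal.mk {L : NExtKTB // HasCodimension 3 L} = Cardinal.continuum ∧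
    -- and so do the varieties of KTB-algebras that cover Var(Cm(K₂))
    Cardinal.mk {V : KTBVariety // KTBVariety.generatedBy {CmK2} ⋖ V} = Cardinal.continuum ∧
    -- the varieties Var(D_N) are pairwise distinct such covers
    (∀ N : Set ℕ, N ⊆ posEven →
      KTBVariety.generatedBy {CmK2} ⋖ KTBVariety.generatedBy {algD N}) ∧
    Set.InjOn (fun N : Set ℕ => KTBVariety.generatedBy {algD N}) {N | N ⊆ posEven} ∧
    -- and their logics are pairwise distinct members of NExt(KTB) of codimension 3
    (∀ N : Set ℕ, N ⊆ posEven → ∃ L : NExtKTB,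
      L.1 = (KTBVariety.generatedBy {algD N}).logic ∧ HasCodimension 3 L) ∧
    Set.InjOn (fun N : Set ℕ => (KTBVariety.generatedBy {algD N}).logic)
      {N | N ⊆ posEven} := by
  have hinj : Set.InjOn (fun N : Set ℕ => KTBVariety.generatedBy {algD N}) {N | N ⊆ posEven} :=
    fun N hN M hM h => injOn_logic_algD hN hM (congrArg KTBVariety.logic h)
  refine ⟨le_antisymm ?_ ?_, le_antisymm ?_ ?_, fun N _ => generatedBy_CmK2_covBy N, hinj,
    fun N _ => ⟨_, rfl, hasCodimension_three_toNExt_algD N⟩, injOn_logic_algD⟩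
  · refine (Cardinal.mk_le_of_injective (f := fun L => L.1.1) fun L L' h => ?_).trans
      mk_set_modalFormula_le
    exact Subtype.ext (Subtype.ext h)
  · refine continuum_le_mk_subset_posEven.trans (Cardinal.mk_le_of_injective
      (f := fun N => ⟨_, hasCodimension_three_toNExt_algD N.1⟩) fun N M h => ?_)
    exact Subtype.ext (injOn_logic_algD N.2 M.2 (congrArg (fun L => L.1.1) h))
  · have h := Cardinal.mk_le_of_injective
      (α := {V : KTBVariety // KTBVariety.generatedBy {CmK2} ⋖ V})
      (β := ULift (Set ModalFormula)) (f := fun V => ⟨V.1.logic⟩)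
      fun V W h => Subtype.ext (KTBVariety.logic_injective (congrArg ULift.down h))
    refine h.trans ?_
    rw [Cardinal.mk_uLift, ← Cardinal.lift_continuum.{1, 0}, Cardinal.lift_le]
    exact mk_set_modalFormula_le
  · rw [← Cardinal.lift_continuum.{1, 0}]
    refine (Cardinal.lift_le.2 continuum_le_mk_subset_posEven).trans ?_
    rw [← Cardinal.mk_uLift]
    refine Cardinal.mk_le_of_injective (f := fun N => ⟨_, generatedBy_CmK2_covBy N.down.1⟩)
      fun N M h => ?_
    exact ULift.ext _ _ (Subtype.ext (hinj N.down.2 M.down.2 (congrArg Subtype.val h)))
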